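/- Let $p,q\ge 0$ be integers, let $A$ and $F$ be constant real $p\times q$ matrices and let $c\in\mathbb C$. On the phase space $T^*SO(p)\times T^*SO(q)$, whose points are written $(k,\ell,r,m)$ with $k\in SO(p)$, $\ell\in so(p)$ (real skew-symmetric matrices), $r\in SO(q)$, $m\in so(q)$, consider the canonical Poisson bracket, extended bilinearly to complex-valued functions, whose only non-zero brackets between coordinates are $$\{\ell_{ij},\ell_{ab}\}=\delta_{ib}\ell_{ja}+\delta_{ja}\ell_{ib}-\delta_{ia}\ell_{jb}-\delta_{jb}\ell_{ia},\qquad \{\ell_{ij},k_{ba}\}=\delta_{ja}k_{bi}-\delta_{ia}k_{bj},$$ $$\{m_{ij},m_{ab}\}=\delta_{ib}m_{ja}+\delta_{ja}m_{ib}-\delta_{ia}m_{jb}-\delta_{jb}m_{ia},\qquad \{m_{ij},r_{ba}\}=\delta_{ja}r_{bi}-\delta_{ia}r_{bj}.$$ In $(p,q)$-block form put $$\mathbf a=\begin{pmatrix}0&kAr^T\\ rA^Tk^T&0\end{pmatrix},\quad \mathbf l=-\begin{pmatrix}k\ell k^T&0\\0&rmr^T\end{pmatrix},\quad \mathbf s=\begin{pmatrix}0&F\\F^T&0\end{pmatrix},\quad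 y=c\begin{pmatrix}0&F\\-F^T&0\end{pmatrix},$$ $\mathbf l'=\mathbf l-\tfrac12(y\mathbf a+\mathbf a y)$, and, for every $\lambda\in\mathbb C\setminus\{0\}$ such that $1-\lambda^{-1}y$ is invertible, $$L_y(\lambda)=(1-\lambda^{-1}y)^{-1}\bigl(\lambda\,\mathbf a+\mathbf l'+\lambda^{-1}\mathbf s\bigr).$$ Then the spectral invariants of $L_y$, that is, the functions $\operatorname{tr}L_y(\lambda)^n$ $(n\ge 0)$ and the coefficients of the characteristic polynomial of $L_y(\lambda)$, for all such $\lambda$, are smooth functions on the phase space and are in involution: $\{f,g\}=0$ for any two of them, taken at arbitrary and possibly different values $\lambda,\mu$ of the spectral parameter. -/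

import Mathlib

open scoped Matrix

noncomputable section

namespace SpinTop

/-- The rotation group `SO(n)`, realised by real orthogonal `n × n` matrices of determinant one. -/
abbrev SO (n : ℕ) : Type := Matrix.specialOrthogonalGroup (Fin n) ℝ

/-- The Lie algebra `so(n)` of real skew-symmetric `n × n` matrices. -/
abbrev LieSO (n : ℕ) : Type := LieAlgebra.Orthogonal.so (Fin n) ℝ

/-- A point `(k, ℓ, r, m)` of `T*SO(p) × T*SO(q)` in the left trivialisation: `k ∈ SO(p)` and
`r ∈ SO(q)` are the configurations, `ℓ ∈ so(p)` and `m ∈ so(q)` are the momenta (angular momenta in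
the body frame). -/
@[ext]
structure PhaseSpace (p q : ℕ) where
  k : SO p
  l : LieSO p
  r : SO q
  m : LieSO q

/-- The matrix `Z_{ij} = E_{ij} - E_{ji}` of `so(n)`. -/
def gen {n : ℕ} (i j : Fin n) : LieSO n :=
  ⟨Matrix.single i j 1 - Matrix.single j i 1, by
    rw [LieAlgebra.Orthogonal.mem_so]
    simp [Matrix.transpose_sub]⟩

theorem exp_mem_orthogonal {n : ℕ} (Z : LieSO n) :
    NormedSpace.exp Z.1 ∈ Matrix.orthogonalGroup (Fin n) ℝ := by
  have hZ : Z.1ᵀ = -Z.1 := (LieAlgebra.Orthogonal.mem_so (Fin n) ℝ Z.1).1 Z.2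
  rw [Matrix.mem_orthogonalGroup_iff, ← Matrix.exp_transpose, hZ,
    ← Matrix.exp_add_of_commute _ _ (Commute.neg_right (Commute.refl Z.1)), add_neg_cancel,
    NormedSpace.exp_zero]

theorem exp_mem_specialOrthogonal {n : ℕ} (Z : LieSO n) :
    NormedSpace.exp Z.1 ∈ Matrix.specialOrthogonalGroup (Fin n) ℝ := by
  rw [Matrix.mem_specialOrthogonalGroup_iff]
  refine ⟨exp_mem_orthogonal Z, ?_⟩
  set W : LieSO n := (2⁻¹ : ℝ) • Z with hW
  have h1 : NormedSpace.exp Z.1 = NormedSpace.exp W.1 * NormedSpace.exp W.1 := by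
    rw [← Matrix.exp_add_of_commute _ _ (Commute.refl W.1)]
    congr 1
    have : W + W = Z := by rw [hW, ← add_smul]; norm_num
    exact (congrArg Subtype.val this).symm
  have h2 := (Matrix.mem_orthogonalGroup_iff (Fin n) ℝ).1 (exp_mem_orthogonal W)
  have h3 := congrArg Matrix.det h2
  rw [Matrix.det_mul, Matrix.det_transpose, Matrix.det_one] at h3
  rw [h1, Matrix.det_mul, h3]

/-- The exponential map `so(n) → SO(n)`. -/
def expSO {n : ℕ} (Z : LieSO n) : SO n := ⟨NormedSpace.exp Z.1, exp_mem_specialOrthogonal Z⟩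

section Poisson

variable {p q : ℕ}

/-- `∂f/∂ℓ_{ij}`, the derivative along `Z_{ij}` in the momentum `ℓ`. -/
def dEll (f : PhaseSpace p q → ℂ) (x : PhaseSpace p q) (i j : Fin p) : ℂ :=
  deriv (fun t : ℝ => f { x with l := x.l + t • gen i j }) 0

/-- The derivative of `f` along the left-invariant vector field `k ↦ k Z_{ij}` on `SO(p)`. -/
def dK (f : PhaseSpace p q → ℂ) (x : PhaseSpace p q) (i j : Fin p) : ℂ :=
  deriv (fun t : ℝ => f { x with k := x.k * expSO (t • gen i j) }) 0

/-- `∂f/∂m_{ij}`, the derivative along `Z_{ij}` in the momentum `m`. -/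
def dEm (f : PhaseSpace p q → ℂ) (x : PhaseSpace p q) (i j : Fin q) : ℂ :=
  deriv (fun t : ℝ => f { x with m := x.m + t • gen i j }) 0

/-- The derivative of `f` along the left-invariant vector field `r ↦ r Z_{ij}` on `SO(q)`. -/
def dR (f : PhaseSpace p q → ℂ) (x : PhaseSpace p q) (i j : Fin q) : ℂ :=
  deriv (fun t : ℝ => f { x with r := x.r * expSO (t • gen i j) }) 0

/-- The Lie-Poisson structure functions of `so(n)*`:
`{X_{ij}, X_{ab}} = δ_{ib} X_{ja} + δ_{ja} X_{ib} - δ_{ia} X_{jb} - δ_{jb} X_{ia}`. -/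
def lieCoeff {n : ℕ} (X : Matrix (Fin n) (Fin n) ℝ) (i j a b : Fin n) : ℝ :=
  (if i = b then X j a else 0) + (if j = a then X i b else 0)
    - (if i = a then X j b else 0) - (if j = b then X i a else 0)

/-- The canonical Poisson bracket of `T*SO(p) × T*SO(q)` in the left trivialisation, extended
complex-bilinearly to complex-valued functions. The independent momentum coordinates are `ℓ_{ij}`
and `m_{ij}` with `i < j`. On coordinate functions it gives the table
`{ℓ_{ij}, ℓ_{ab}} = δ_{ib} ℓ_{ja} + δ_{ja} ℓ_{ib} - δ_{ia} ℓ_{jb} - δ_{jb} ℓ_{ia}`,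
`{ℓ_{ij}, k_{ba}} = (k Z_{ij})_{ba} = δ_{ja} k_{bi} - δ_{ia} k_{bj}`,
the same table for `(m, r)`, and zero for all other pairs of coordinates. -/
def poissonBracket (f g : PhaseSpace p q → ℂ) (x : PhaseSpace p q) : ℂ :=
  (∑ i : Fin p, ∑ j ∈ Finset.Ioi i, (dEll f x i j * dK g x i j - dK f x i j * dEll g x i j))
  + (∑ i : Fin p, ∑ j ∈ Finset.Ioi i, ∑ a : Fin p, ∑ b ∈ Finset.Ioi a,
      (lieCoeff x.l.1 i j a b : ℂ) * dEll f x i j * dEll g x a b)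
  + (∑ i : Fin q, ∑ j ∈ Finset.Ioi i, (dEm f x i j * dR g x i j - dR f x i j * dEm g x i j))
  + (∑ i : Fin q, ∑ j ∈ Finset.Ioi i, ∑ a : Fin q, ∑ b ∈ Finset.Ioi a,
      (lieCoeff x.m.1 i j a b : ℂ) * dEm f x i j * dEm g x a b)

/-- Smooth functions on the phase space: restrictions of smooth functions of the matrix entries of
`k`, `ℓ`, `r`, `m` (the phase space is a closed submanifold of the space of these entries). -/
def IsSmooth (f : PhaseSpace p q → ℂ) : Prop :=
  ∃ F : (Fin p → Fin p → ℝ) × (Fin p → Fin p → ℝ) × (Fin q → Fin q → ℝ) × (Fin q → Fin q → ℝ) → ℂ,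
    ContDiff ℝ (⊤ : ℕ∞) F ∧
      ∀ x : PhaseSpace p q,
        f x = F (fun i j => x.k.1 i j, fun i j => x.l.1 i j,
          fun i j => x.r.1 i j, fun i j => x.m.1 i j)

end Poisson

section LaxMatrix

variable {p q : ℕ}

/-- Complex `(p+q) × (p+q)` matrices in `(p,q)`-block form. -/
abbrev BlockMatrix (p q : ℕ) : Type := Matrix (Fin p ⊕ Fin q) (Fin p ⊕ Fin q) ℂ

/-- A real matrix regarded as a complex one. -/
def complexify {ι : Type*} (X : Matrix ι ι ℝ) : Matrix ι ι ℂ := X.map Complex.ofReal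

/-- `a = [[0, k A rᵀ], [r Aᵀ kᵀ, 0]]`. -/
def laxA (A : Matrix (Fin p) (Fin q) ℝ) (x : PhaseSpace p q) : BlockMatrix p q :=
  complexify (Matrix.fromBlocks 0 (x.k.1 * A * x.r.1ᵀ) (x.r.1 * Aᵀ * x.k.1ᵀ) 0)

/-- `l = -[[k ℓ kᵀ, 0], [0, r m rᵀ]]`. -/
def laxL (x : PhaseSpace p q) : BlockMatrix p q :=
  complexify (-Matrix.fromBlocks (x.k.1 * x.l.1 * x.k.1ᵀ) 0 0 (x.r.1 * x.m.1 * x.r.1ᵀ))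

/-- `s = [[0, F], [Fᵀ, 0]]`. -/
def laxS (F : Matrix (Fin p) (Fin q) ℝ) : BlockMatrix p q :=
  complexify (Matrix.fromBlocks 0 F Fᵀ 0)

/-- `y = c [[0, F], [-Fᵀ, 0]]`. -/
def laxY (F : Matrix (Fin p) (Fin q) ℝ) (c : ℂ) : BlockMatrix p q :=
  c • complexify (Matrix.fromBlocks 0 F (-Fᵀ) 0)

/-- `l' = l - ½ (y a + a y)`. -/
def laxL' (A F : Matrix (Fin p) (Fin q) ℝ) (c : ℂ) (x : PhaseSpace p q) : BlockMatrix p q :=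
  laxL x - (1 / 2 : ℂ) • (laxY F c * laxA A x + laxA A x * laxY F c)

/-- The deformed Lax matrix `L_y(λ) = (1 - λ⁻¹ y)⁻¹ (λ a + l' + λ⁻¹ s)`. -/
def deformedLax (A F : Matrix (Fin p) (Fin q) ℝ) (c lam : ℂ) (x : PhaseSpace p q) :
    BlockMatrix p q :=
  (1 - lam⁻¹ • laxY F c)⁻¹ * (lam • laxA A x + laxL' A F c x + lam⁻¹ • laxS F)

/-- The values of the spectral parameter at which `L_y` is defined. -/
def IsRegular (F : Matrix (Fin p) (Fin q) ℝ) (c lam : ℂ) : Prop :=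
  lam ≠ 0 ∧ IsUnit (1 - lam⁻¹ • laxY F c)

/-- The spectral invariants of `L_y`: the traces of powers of `L_y(λ)` and the coefficients of its
characteristic polynomial, for all admissible values of `λ`, as functions on the phase space. -/
def spectralInvariants (A F : Matrix (Fin p) (Fin q) ℝ) (c : ℂ) : Set (PhaseSpace p q → ℂ) :=
  {f | ∃ lam : ℂ, IsRegular F c lam ∧ ∃ n : ℕ,
    (f = fun x => Matrix.trace (deformedLax A F c lam x ^ n)) ∨
    (f = fun x => (Matrix.charpoly (deformedLax A F c lam x)).coeff n)}

end LaxMatrix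

end SpinTop

end

open scoped Matrix

noncomputable section

namespace SpinTop

/-! ### The trace identity that makes the bracket vanish for `λ² ≠ μ²`. -/

section Algebra

variable {ι : Type*} [Fintype ι]

open Matrix

/-! A spectral invariant has the form `φ(L_y(λ))` with `φ` smooth and cyclic, `φ(XY) = φ(YX)`, so
its gradient `M` for the trace form commutes with `L_y(λ)`. Put `D = 1 - λ⁻¹y`, `T = λ²a + s` and `U
= M D⁻¹`. The commutation then reads, free of inverses, `λ[U, T + λl'] = y U (T + λl') - (T + λl') U
y`.

Let `J = diag(1, -1)`. Variations of `l'` are skew and commute with `J`; variations of `a` are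
symmetric and anticommute with `J`. Hence only two components of `U` are seen by derivatives along
the phase space: `V` of the first symmetry type and `O` of the second. The map `θ(X) = -J Xᵀ J`
fixes `T` and `l'`, negates `y`, and carries the relation for `U` to the same relation for `θ(U)`.
So `V + O = (U + θ(U))/2` satisfies it too, and parity under `J` splits it into two equations
(`parity_parts_relation`, `exists_gradient`).

After conjugation by `diag(k, r)` the bracket of two invariants is `2(tr VG' - tr V'G + tr
l[V,V'])`, where `G`, `G'` are the gradients in the configuration variables
(`poissonBracket_eq_trace`). Pairing the two equations at `λ` with `V'`, `O'` and the two at `μ`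
with `V`, `O` yields `λμ(λ² - μ²)` times half the bracket, up to `tr(s O y O') - tr(s O' y O)`. This
remainder vanishes because `y = cJs` and `O` anticommutes with `J` (`trace_involution_identity`).

The excluded case `λ² = μ²`, which contains `λ = μ`, follows since the bracket is continuous in `μ`
and the exceptional values of `μ` are isolated (`poissonBracket_spectral_eq_zero`). -/

theorem trace_cycle₃ (a b c : Matrix ι ι ℂ) : trace (a * (b * c)) = trace (b * (c * a)) := by
  rw [trace_mul_comm, Matrix.mul_assoc]

theorem trace_cycle₄ (a b c d : Matrix ι ι ℂ) :
    trace (a * (b * (c * d))) = trace (b * (c * (d * a))) := by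
  rw [trace_mul_comm, Matrix.mul_assoc, Matrix.mul_assoc]

/-- The trace identity behind the involutivity of the spectral invariants, for `λ² ≠ μ²`. -/
theorem trace_involution_identity {a l s y J V O V' O' : Matrix ι ι ℂ} {c lam mu : ℂ}
    (hs : s * J = -(J * s)) (hy : y = c • (J * s))
    (hO : O * J = -(J * O))
    (he : lam • (lam • (V * l - l * V) + (O * (lam ^ 2 • a + s) - (lam ^ 2 • a + s) * O)) =
      y * (V * (lam ^ 2 • a + s) + lam • (O * l)) - ((lam ^ 2 • a + s) * V + lam • (l * O)) * y)
    (ho : lam • ((V * (lam ^ 2 • a + s) - (lam ^ 2 • a + s) * V) + lam • (O * l - l * O)) =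
      y * (lam • (V * l) + O * (lam ^ 2 • a + s)) - (lam • (l * V) + (lam ^ 2 • a + s) * O) * y)
    (he' : mu • (mu • (V' * l - l * V') + (O' * (mu ^ 2 • a + s) - (mu ^ 2 • a + s) * O')) =
      y * (V' * (mu ^ 2 • a + s) + mu • (O' * l)) - ((mu ^ 2 • a + s) * V' + mu • (l * O')) * y)
    (ho' : mu • ((V' * (mu ^ 2 • a + s) - (mu ^ 2 • a + s) * V') + mu • (O' * l - l * O')) =
      y * (mu • (V' * l) + O' * (mu ^ 2 • a + s)) - (mu • (l * V') + (mu ^ 2 • a + s) * O') * y)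
    (hlam : lam ≠ 0) (hmu : mu ≠ 0) (hne : lam ^ 2 ≠ mu ^ 2) :
    mu * trace ((V * a - a * V) * O') - lam * trace ((V' * a - a * V') * O)
      - trace (l * (V * V' - V' * V)) + trace (a * V * y * V') - trace (a * V' * y * V) = 0 := by
  -- The only term not cancelled by the four equations; this is the one place where the special form
  -- `y = cJs` enters.
  have hres : trace (s * (O * (y * O'))) = trace (s * (O' * (y * O))) := by
    have h1 : s * (O * (J * (s * O'))) = J * (s * (O * (s * O'))) := by
      rw [← Matrix.mul_assoc O J, hO, Matrix.neg_mul, Matrix.mul_neg, Matrix.mul_assoc J,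
        ← Matrix.mul_assoc s J, hs]
      simp [Matrix.mul_assoc]
    have h2 : trace (s * (O' * (J * (s * O)))) = trace (J * (s * (O * (s * O')))) := by
      rw [trace_mul_comm, Matrix.mul_assoc, Matrix.mul_assoc, Matrix.mul_assoc,
        trace_mul_comm, Matrix.mul_assoc, Matrix.mul_assoc, Matrix.mul_assoc]
    subst hy
    simp only [smul_mul_assoc, mul_smul_comm, Matrix.mul_assoc, trace_smul, h1, h2]
  have e1 := congrArg (fun X => trace (X * V')) he
  have e2 := congrArg (fun X => trace (X * O')) ho
  have e3 := congrArg (fun X => trace (X * V)) he'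
  have e4 := congrArg (fun X => trace (X * O)) ho'
  have hk : lam * mu * (lam ^ 2 - mu ^ 2) ≠ 0 :=
    mul_ne_zero (mul_ne_zero hlam hmu) (sub_ne_zero.2 hne)
  clear he ho he' ho' hy
  simp only [smul_mul_assoc, mul_smul_comm, Matrix.mul_assoc, trace_smul, Matrix.mul_add,
    Matrix.add_mul, Matrix.mul_sub, Matrix.sub_mul, trace_add, trace_sub, smul_add, smul_sub,
    smul_eq_mul] at e1 e2 e3 e4 ⊢
  -- Elimination among the four equations produces the goal multiplied by `λμ(λ² - μ²)`.
  apply (mul_eq_zero.1 _).resolve_left hk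
  -- Each word contains exactly one of `a`, `l`, `s`; rotating that letter to the front gives a
  -- normal form for cyclic words.
  simp only [trace_cycle₃ V, trace_cycle₃ O, trace_cycle₃ V', trace_cycle₃ O', trace_cycle₄ y,
    Matrix.mul_assoc] at e1 e2 e3 e4 hres ⊢
  linear_combination lam * mu * e1 + mu ^ 2 * e2 + lam * mu * e3 + lam ^ 2 * e4
    + (lam ^ 2 - mu ^ 2) * hres

end Algebra

/-! ### Sums over the basis `Z_{ij}`, `i < j`, of `so(n)` as traces. -/

section PairSums

open Matrix

variable {n : ℕ}

theorem two_mul_sum_Ioi (h : Fin n → Fin n → ℂ) (hsymm : ∀ i j, h j i = h i j)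
    (hdiag : ∀ i, h i i = 0) :
    2 * ∑ i, ∑ j ∈ Finset.Ioi i, h i j = ∑ i, ∑ j, h i j := by
  have h1 : ∑ i, ∑ j ∈ Finset.Ioi i, h i j = ∑ i, ∑ j, if i < j then h i j else 0 := by
    refine Finset.sum_congr rfl fun i _ => ?_
    rw [← Finset.sum_filter]
    congr 1
    ext j
    simp
  have h2 : ∑ i, ∑ j ∈ Finset.Ioi i, h i j = ∑ i, ∑ j, if j < i then h i j else 0 := by
    rw [h1, Finset.sum_comm]
    simp only [hsymm]
  rw [two_mul]
  nth_rewrite 1 [h1]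
  rw [h2, ← Finset.sum_add_distrib]
  refine Finset.sum_congr rfl fun i _ => ?_
  rw [← Finset.sum_add_distrib]
  refine Finset.sum_congr rfl fun j _ => ?_
  rcases lt_trichotomy i j with hij | rfl | hij
  · simp [hij, hij.not_gt]
  · simp [hdiag]
  · simp [hij, hij.not_gt]

theorem trace_mul_gen (v : Matrix (Fin n) (Fin n) ℂ) (i j : Fin n) :
    trace (v * complexify (gen i j).1) = v j i - v i j := by
  have : complexify (gen i j).1 = single i j (1 : ℂ) - single j i 1 := by
    ext a b
    simp only [complexify, gen, map_apply, Matrix.sub_apply, single_apply]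
    split_ifs <;> simp
  rw [this, Matrix.mul_sub, trace_sub, trace_mul_single, trace_mul_single]
  simp

/-- For skew `v` one has `tr(v Z_{ij}) = -2 v_{ij}`. The other factor needs no symmetry, since its
symmetric part is orthogonal to `v`. -/
theorem sum_Ioi_trace_gen_mul {v : Matrix (Fin n) (Fin n) ℂ} (hv : vᵀ = -v)
    (g : Matrix (Fin n) (Fin n) ℂ) :
    ∑ i, ∑ j ∈ Finset.Ioi i, trace (v * complexify (gen i j).1) * trace (g * complexify (gen i j).1)
      = -2 * trace (v * g) := by
  have hv' : ∀ i j, v j i = -v i j := fun i j => congrFun (congrFun hv i) j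
  have h1 : ∑ i, ∑ j, v i j * g i j = -trace (v * g) := by
    simp only [trace, diag, mul_apply]
    rw [Finset.sum_comm, ← Finset.sum_neg_distrib]
    refine Finset.sum_congr rfl fun i _ => ?_
    rw [← Finset.sum_neg_distrib]
    refine Finset.sum_congr rfl fun j _ => ?_
    rw [hv' i j]; ring
  have h2 : ∑ i, ∑ j, v i j * g j i = trace (v * g) := by
    simp only [trace, diag, mul_apply]
  have h3 := two_mul_sum_Ioi (fun i j => trace (v * complexify (gen i j).1) *
    trace (g * complexify (gen i j).1)) (fun i j => by simp only [trace_mul_gen]; ring)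
    (fun i => by simp only [trace_mul_gen]; ring)
  have h4 : ∑ i, ∑ j, trace (v * complexify (gen i j).1) * trace (g * complexify (gen i j).1)
      = 2 * ∑ i, ∑ j, v i j * g i j - 2 * ∑ i, ∑ j, v i j * g j i := by
    simp only [Finset.mul_sum, ← Finset.sum_sub_distrib, trace_mul_gen]
    refine Finset.sum_congr rfl fun i _ => Finset.sum_congr rfl fun j _ => ?_
    rw [hv' i j]; ring
  rw [h4, h1, h2] at h3
  linear_combination h3 / 2

theorem lieCoeff_swap_left (X : Matrix (Fin n) (Fin n) ℝ) (i j a b : Fin n) :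
    lieCoeff X j i a b = -lieCoeff X i j a b := by
  simp only [lieCoeff]; ring

theorem lieCoeff_swap_right {X : Matrix (Fin n) (Fin n) ℝ} (i j a b : Fin n) :
    lieCoeff X i j b a = -lieCoeff X i j a b := by
  simp only [lieCoeff]; ring

/-- Each of the four Kronecker deltas collapses one index and, by skewness of the matrices,
contributes the same trace. -/
theorem sum_lieCoeff {X : Matrix (Fin n) (Fin n) ℝ} (hX : Xᵀ = -X)
    {v v' : Matrix (Fin n) (Fin n) ℂ} (hv : vᵀ = -v) (hv' : v'ᵀ = -v') :
    ∑ i, ∑ j, ∑ a, ∑ b, (lieCoeff X i j a b : ℂ) * v i j * v' a b =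
      4 * trace (complexify X * v' * v) := by
  have hX1 : ∀ i j, X j i = -X i j := fun i j => congrFun (congrFun hX i) j
  have hv1 : ∀ i j, v j i = -v i j := fun i j => congrFun (congrFun hv i) j
  have hv1' : ∀ i j, v' j i = -v' i j := fun i j => congrFun (congrFun hv' i) j
  have h1 : trace (complexify X * v' * v) = ∑ i, ∑ j, ∑ a, (X j a : ℂ) * v i j * v' a i := by
    simp only [trace, diag, mul_apply, complexify, map_apply, Finset.sum_mul]
    rw [Finset.sum_comm]
    refine Finset.sum_congr rfl fun i _ => Finset.sum_congr rfl fun j _ =>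
      Finset.sum_congr rfl fun a _ => ?_
    ring
  have h2 : trace (complexify X * v' * v) = ∑ i, ∑ j, ∑ b, (X i b : ℂ) * v i j * v' j b := by
    rw [h1, Finset.sum_comm]
    refine Finset.sum_congr rfl fun i _ => Finset.sum_congr rfl fun j _ =>
      Finset.sum_congr rfl fun a _ => ?_
    rw [hv1 i j, hv1' j a]; ring
  have e1 : ∀ i j, ∑ a, ∑ b, ((if i = b then X j a else 0 : ℝ) : ℂ) * v i j * v' a b =
      ∑ a, (X j a : ℂ) * v i j * v' a i := by
    intro i j
    refine Finset.sum_congr rfl fun a _ => ?_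
    rw [Finset.sum_eq_single i (by intro b _ hb; simp [hb.symm]) (by simp)]
    simp
  have e2 : ∀ i j, ∑ a, ∑ b, ((if j = a then X i b else 0 : ℝ) : ℂ) * v i j * v' a b =
      ∑ b, (X i b : ℂ) * v i j * v' j b := by
    intro i j
    rw [Finset.sum_eq_single j (by intro b _ hb; simp [hb.symm]) (by simp)]
    simp
  have e3 : ∀ i j, ∑ a, ∑ b, ((if i = a then X j b else 0 : ℝ) : ℂ) * v i j * v' a b =
      -∑ b, (X j b : ℂ) * v i j * v' b i := by
    intro i j
    rw [Finset.sum_eq_single i (by intro b _ hb; simp [hb.symm]) (by simp),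
      ← Finset.sum_neg_distrib]
    refine Finset.sum_congr rfl fun b _ => ?_
    rw [hv1' i b]; simp
  have e4 : ∀ i j, ∑ a, ∑ b, ((if j = b then X i a else 0 : ℝ) : ℂ) * v i j * v' a b =
      -∑ a, (X i a : ℂ) * v i j * v' j a := by
    intro i j
    rw [← Finset.sum_neg_distrib]
    refine Finset.sum_congr rfl fun a _ => ?_
    rw [Finset.sum_eq_single j (by intro b _ hb; simp [hb.symm]) (by simp), hv1' j a]
    simp
  simp only [lieCoeff, Complex.ofReal_add, Complex.ofReal_sub, add_mul, sub_mul,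
    Finset.sum_add_distrib, Finset.sum_sub_distrib, e1, e2, e3, e4, Finset.sum_neg_distrib]
  rw [← h1, ← h2]
  ring

/-- The factor `(-2)²` from the two traces cancels the two halvings incurred in passing from all
pairs to pairs `i < j`. -/
theorem sum_Ioi_lieCoeff {X : Matrix (Fin n) (Fin n) ℝ} (hX : Xᵀ = -X)
    {v v' : Matrix (Fin n) (Fin n) ℂ} (hv : vᵀ = -v) (hv' : v'ᵀ = -v') :
    ∑ i, ∑ j ∈ Finset.Ioi i, ∑ a, ∑ b ∈ Finset.Ioi a, (lieCoeff X i j a b : ℂ) *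
        trace (v * complexify (gen i j).1) * trace (v' * complexify (gen a b).1) =
      4 * trace (complexify X * v' * v) := by
  have hv1 : ∀ i j, v j i = -v i j := fun i j => congrFun (congrFun hv i) j
  have hv1' : ∀ i j, v' j i = -v' i j := fun i j => congrFun (congrFun hv' i) j
  have t : ∀ i j, trace (v * complexify (gen i j).1) = -2 * v i j := fun i j => by
    rw [trace_mul_gen, hv1 i j]; ring
  have t' : ∀ i j, trace (v' * complexify (gen i j).1) = -2 * v' i j := fun i j => by
    rw [trace_mul_gen, hv1' i j]; ring
  have d' : ∀ i, v' i i = 0 := fun i => by linear_combination hv1' i i / 2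
  have d : ∀ i, v i i = 0 := fun i => by linear_combination hv1 i i / 2
  have inner : ∀ i j, ∑ a, ∑ b ∈ Finset.Ioi a, (lieCoeff X i j a b : ℂ) *
      trace (v * complexify (gen i j).1) * trace (v' * complexify (gen a b).1) =
      2 * ∑ a, ∑ b, (lieCoeff X i j a b : ℂ) * v i j * v' a b := by
    intro i j
    have := two_mul_sum_Ioi (fun a b => (lieCoeff X i j a b : ℂ) * v i j * v' a b)
      (fun a b => by simp only [lieCoeff_swap_right i j a b, hv1' a b]; push_cast; ring)
      (fun a => by simp only [d']; ring)
    rw [← this]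
    simp only [t, t', Finset.mul_sum]
    refine Finset.sum_congr rfl fun a _ => Finset.sum_congr rfl fun b _ => ?_
    ring
  simp only [inner]
  have := two_mul_sum_Ioi (fun i j => ∑ a, ∑ b, (lieCoeff X i j a b : ℂ) * v i j * v' a b)
    (fun i j => by
      refine Finset.sum_congr rfl fun a _ => Finset.sum_congr rfl fun b _ => ?_
      rw [lieCoeff_swap_left X i j a b, hv1 i j]; push_cast; ring)
    (fun i => by simp [d])
  rw [← sum_lieCoeff hX hv hv', ← this]
  simp only [Finset.mul_sum]

/-- The contribution of one factor `T*SO(n)` to a Poisson bracket, in terms of gradients. -/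
theorem sum_Ioi_bracket {X : Matrix (Fin n) (Fin n) ℝ} (hX : Xᵀ = -X)
    {v v' : Matrix (Fin n) (Fin n) ℂ} (hv : vᵀ = -v) (hv' : v'ᵀ = -v')
    (g g' : Matrix (Fin n) (Fin n) ℂ) {e k e' k' : Fin n → Fin n → ℂ}
    (he : ∀ i j, e i j = -trace (v * complexify (gen i j).1))
    (he' : ∀ i j, e' i j = -trace (v' * complexify (gen i j).1))
    (hk : ∀ i j, k i j = trace (g * complexify (gen i j).1))
    (hk' : ∀ i j, k' i j = trace (g' * complexify (gen i j).1)) :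
    (∑ i, ∑ j ∈ Finset.Ioi i, (e i j * k' i j - k i j * e' i j)) +
      (∑ i, ∑ j ∈ Finset.Ioi i, ∑ a, ∑ b ∈ Finset.Ioi a,
        (lieCoeff X i j a b : ℂ) * e i j * e' a b) =
    2 * (trace (v * g') - trace (v' * g) + 2 * trace (complexify X * v' * v)) := by
  have h1 := sum_Ioi_trace_gen_mul hv g'
  have h2 := sum_Ioi_trace_gen_mul hv' g
  have h3 := sum_Ioi_lieCoeff hX hv hv'
  have h4 : ∑ i, ∑ j ∈ Finset.Ioi i, (e i j * k' i j - k i j * e' i j) =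
      -(-2 * trace (v * g')) + -2 * trace (v' * g) := by
    rw [← h1, ← h2]
    simp only [← Finset.sum_neg_distrib, ← Finset.sum_add_distrib]
    refine Finset.sum_congr rfl fun i _ => Finset.sum_congr rfl fun j _ => ?_
    rw [he, he', hk, hk']; ring
  rw [h4]
  simp only [he, he', mul_neg, neg_mul, neg_neg]
  rw [h3]
  ring

end PairSums

/-! ### Symmetry types under transposition and conjugation by `J`. -/

section Symmetrization

open Matrix

variable {ι : Type*} [Fintype ι]

/-- The component of a matrix that is skew-symmetric and commutes with the involution `J`. -/
def evenPart (J U : Matrix ι ι ℂ) : Matrix ι ι ℂ :=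
  (4⁻¹ : ℂ) • (U + J * U * J - Uᵀ - J * Uᵀ * J)

/-- The component of a matrix that is symmetric and anticommutes with the involution `J`. -/
def oddPart (J U : Matrix ι ι ℂ) : Matrix ι ι ℂ :=
  (4⁻¹ : ℂ) • (U - J * U * J + Uᵀ - J * Uᵀ * J)

theorem transpose_evenPart {J : Matrix ι ι ℂ} (hJt : Jᵀ = J) (U : Matrix ι ι ℂ) :
    (evenPart J U)ᵀ = -evenPart J U := by
  simp only [evenPart, transpose_smul, transpose_add, transpose_sub, transpose_mul,
    transpose_transpose, hJt, Matrix.mul_assoc]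
  module

/-- The components of `U` of the other two symmetry types drop out: `X ↦ -J Xᵀ J` preserves the form
of the relation, because it fixes `T` and `l` and negates both `y` and the order of the factors
around it. The two conclusions are the parts of the symmetrized relation that commute and
anticommute with `J`. -/
theorem parity_parts_relation {J T l y U : Matrix ι ι ℂ} {lam : ℂ}
    (hT : T * J = -(J * T)) (hTt : Tᵀ = T) (hl : l * J = J * l) (hlt : lᵀ = -l)
    (hy : y * J = -(J * y)) (hyt : yᵀ = -y)
    (h : lam • (U * (T + lam • l) - (T + lam • l) * U) =
      y * U * (T + lam • l) - (T + lam • l) * U * y) :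
    lam • (lam • (evenPart J U * l - l * evenPart J U) + (oddPart J U * T - T * oddPart J U)) =
      y * (evenPart J U * T + lam • (oddPart J U * l))
        - (T * evenPart J U + lam • (l * oddPart J U)) * y ∧
    lam • ((evenPart J U * T - T * evenPart J U) + lam • (oddPart J U * l - l * oddPart J U)) =
      y * (lam • (evenPart J U * l) + oddPart J U * T)
        - (lam • (l * evenPart J U) + T * oddPart J U) * y := by
  have hT' : ∀ X, T * (J * X) = -(J * (T * X)) := fun X => by
    rw [← Matrix.mul_assoc, hT, Matrix.neg_mul, Matrix.mul_assoc]
  have hl' : ∀ X, l * (J * X) = J * (l * X) := fun X => by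
    rw [← Matrix.mul_assoc, hl, Matrix.mul_assoc]
  have hy' : ∀ X, y * (J * X) = -(J * (y * X)) := fun X => by
    rw [← Matrix.mul_assoc, hy, Matrix.neg_mul, Matrix.mul_assoc]
  have h2 := congrArg (fun X => J * X * J) h
  have h3 := congrArg transpose h
  have h4 := congrArg (fun X => J * X * J) h3
  simp only [transpose_smul, transpose_add, transpose_sub, transpose_mul, hTt, hlt, hyt] at h3 h4
  simp only [evenPart, oddPart, smul_mul_assoc, mul_smul_comm, Matrix.mul_add, Matrix.add_mul,
    Matrix.mul_sub, Matrix.sub_mul, Matrix.mul_assoc, Matrix.mul_neg, Matrix.neg_mul,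
    hT', hl', hy', hT, hl, hy, smul_neg, neg_neg, smul_add, smul_sub] at h h2 h3 h4 ⊢
  -- The signs attached to the relation, its conjugate, its transpose and its conjugated transpose
  -- are those defining `evenPart` and `oddPart`.
  constructor
  · linear_combination (norm := module)
      (4⁻¹ : ℂ) • h + (4⁻¹ : ℂ) • h2 - (4⁻¹ : ℂ) • h3 - (4⁻¹ : ℂ) • h4
  · linear_combination (norm := module)
      (4⁻¹ : ℂ) • h - (4⁻¹ : ℂ) • h2 + (4⁻¹ : ℂ) • h3 - (4⁻¹ : ℂ) • h4

variable [DecidableEq ι] {J : Matrix ι ι ℂ}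

theorem evenPart_comm (hJ : J * J = 1) (U : Matrix ι ι ℂ) :
    evenPart J U * J = J * evenPart J U := by
  have h : ∀ X, J * (J * X) = X := fun X => by rw [← Matrix.mul_assoc, hJ, Matrix.one_mul]
  simp only [evenPart, smul_mul_assoc, mul_smul_comm, Matrix.mul_add, Matrix.add_mul,
    Matrix.mul_sub, Matrix.sub_mul, Matrix.mul_assoc, hJ, h, Matrix.mul_one]
  module

theorem oddPart_anticomm (hJ : J * J = 1) (U : Matrix ι ι ℂ) :
    oddPart J U * J = -(J * oddPart J U) := by
  have h : ∀ X, J * (J * X) = X := fun X => by rw [← Matrix.mul_assoc, hJ, Matrix.one_mul]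
  simp only [oddPart, smul_mul_assoc, mul_smul_comm, Matrix.mul_add, Matrix.add_mul,
    Matrix.mul_sub, Matrix.sub_mul, Matrix.mul_assoc, hJ, h, Matrix.mul_one]
  module

/-- The trace form makes distinct symmetry types orthogonal, so a test matrix sees only the
component of its own type. -/
theorem trace_evenPart_mul {E : Matrix ι ι ℂ} (hJ : J * J = 1) (hE : E * J = J * E)
    (hEt : Eᵀ = -E) (U : Matrix ι ι ℂ) : trace (evenPart J U * E) = trace (U * E) := by
  have h : ∀ X, trace (J * X * J * E) = trace (X * E) := fun X => by
    rw [Matrix.mul_assoc _ J E, ← hE, Matrix.mul_assoc, trace_mul_comm, Matrix.mul_assoc,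
      Matrix.mul_assoc, hJ, Matrix.mul_one]
  have h' : trace (Uᵀ * E) = -trace (U * E) := by
    rw [← trace_transpose, transpose_mul, transpose_transpose, hEt, Matrix.neg_mul, trace_neg,
      trace_mul_comm]
  simp only [evenPart, smul_mul_assoc, Matrix.add_mul, Matrix.sub_mul, trace_smul, trace_add,
    trace_sub, h, h', smul_eq_mul]
  ring

theorem trace_oddPart_mul {C : Matrix ι ι ℂ} (hJ : J * J = 1) (hC : C * J = -(J * C))
    (hCt : Cᵀ = C) (U : Matrix ι ι ℂ) : trace (oddPart J U * C) = trace (U * C) := by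
  have hC' : J * C = -(C * J) := by rw [hC, neg_neg]
  have h : ∀ X, trace (J * X * J * C) = -trace (X * C) := fun X => by
    rw [Matrix.mul_assoc _ J C, hC', Matrix.mul_neg, trace_neg, Matrix.mul_assoc, trace_mul_comm,
      Matrix.mul_assoc, Matrix.mul_assoc, hJ, Matrix.mul_one]
  have h' : trace (Uᵀ * C) = trace (U * C) := by
    rw [← trace_transpose, transpose_mul, transpose_transpose, hCt, trace_mul_comm]
  simp only [oddPart, smul_mul_assoc, Matrix.add_mul, Matrix.sub_mul, trace_smul, trace_add,
    trace_sub, h, h', smul_eq_mul]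
  ring

end Symmetrization

/-! ### The Lax matrix in the frame `diag(k, r)`, and the symmetry types of its ingredients. -/

section Frames

open Matrix

variable {p q : ℕ}

/-- The block signature matrix `diag(1, -1)`. -/
def signature (p q : ℕ) : BlockMatrix p q := fromBlocks 1 0 0 (-1)

/-- The block rotation `diag(k, r)`. -/
def frame (x : PhaseSpace p q) : BlockMatrix p q :=
  fromBlocks (complexify x.k.1) 0 0 (complexify x.r.1)

/-- The block momentum `diag(ℓ, m)`. -/
def momentum (x : PhaseSpace p q) : BlockMatrix p q :=
  fromBlocks (complexify x.l.1) 0 0 (complexify x.m.1)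

theorem complexify_fromBlocks {m n : Type*} (a : Matrix m m ℝ) (b : Matrix m n ℝ)
    (c : Matrix n m ℝ) (d : Matrix n n ℝ) :
    complexify (fromBlocks a b c d) = fromBlocks (complexify a) (b.map Complex.ofReal)
      (c.map Complex.ofReal) (complexify d) :=
  fromBlocks_map _ _ _ _ _

theorem complexify_mul {n : Type*} [Fintype n] (a b : Matrix n n ℝ) :
    complexify (a * b) = complexify a * complexify b :=
  Matrix.map_mul (f := Complex.ofRealHom)

theorem complexify_transpose {n : Type*} (a : Matrix n n ℝ) :
    complexify aᵀ = (complexify a)ᵀ := rfl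

theorem complexify_neg {n : Type*} (a : Matrix n n ℝ) : complexify (-a) = -complexify a := by
  ext; simp [complexify]

theorem complexify_zero {n : Type*} : complexify (0 : Matrix n n ℝ) = 0 := by
  ext; simp [complexify]

theorem complexify_one {n : Type*} [DecidableEq n] : complexify (1 : Matrix n n ℝ) = 1 :=
  Matrix.map_one _ Complex.ofReal_zero Complex.ofReal_one

theorem transpose_mul_self_SO {n : ℕ} (g : SO n) : g.1ᵀ * g.1 = 1 :=
  (mem_orthogonalGroup_iff' (Fin n) ℝ).1 (mem_specialOrthogonalGroup_iff.1 g.2).1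

theorem transpose_LieSO {n : ℕ} (Z : LieSO n) : Z.1ᵀ = -Z.1 :=
  (LieAlgebra.Orthogonal.mem_so (Fin n) ℝ Z.1).1 Z.2

theorem signature_mul_self : signature p q * signature p q = 1 := by
  simp [signature, fromBlocks_multiply]

theorem transpose_signature : (signature p q)ᵀ = signature p q := by
  simp [signature, fromBlocks_transpose]

theorem frame_eq (x : PhaseSpace p q) : frame x = complexify (fromBlocks x.k.1 0 0 x.r.1) := by
  rw [complexify_fromBlocks]; simp [frame]

theorem momentum_eq (x : PhaseSpace p q) :
    momentum x = complexify (fromBlocks x.l.1 0 0 x.m.1) := by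
  rw [complexify_fromBlocks]; simp [momentum]

theorem transpose_frame_mul_frame (x : PhaseSpace p q) : (frame x)ᵀ * frame x = 1 := by
  rw [frame_eq, ← complexify_transpose, ← complexify_mul, fromBlocks_transpose,
    fromBlocks_multiply]
  simp [transpose_mul_self_SO, complexify_one]

theorem frame_mul_transpose_frame (x : PhaseSpace p q) : frame x * (frame x)ᵀ = 1 :=
  mul_eq_one_comm.1 (transpose_frame_mul_frame x)

theorem frame_comm_signature (x : PhaseSpace p q) :
    frame x * signature p q = signature p q * frame x := by
  simp [frame, signature, fromBlocks_multiply]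

theorem momentum_comm_signature (x : PhaseSpace p q) :
    momentum x * signature p q = signature p q * momentum x := by
  simp [momentum, signature, fromBlocks_multiply]

theorem transpose_momentum (x : PhaseSpace p q) : (momentum x)ᵀ = -momentum x := by
  rw [momentum_eq, ← complexify_transpose, ← complexify_neg, fromBlocks_transpose,
    transpose_LieSO, transpose_LieSO, fromBlocks_neg]
  simp

theorem laxS_anticomm (F : Matrix (Fin p) (Fin q) ℝ) :
    laxS F * signature p q = -(signature p q * laxS F) := by
  rw [laxS, complexify_fromBlocks]
  simp [signature, fromBlocks_multiply, fromBlocks_neg, complexify_zero]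

theorem transpose_laxS (F : Matrix (Fin p) (Fin q) ℝ) : (laxS F)ᵀ = laxS F := by
  rw [laxS, ← complexify_transpose, fromBlocks_transpose]
  simp

/-- This proportionality of `y` to `J s` is what the residual term of `trace_involution_identity`
requires. -/
theorem laxY_eq (F : Matrix (Fin p) (Fin q) ℝ) (c : ℂ) :
    laxY F c = c • (signature p q * laxS F) := by
  rw [laxS, laxY, complexify_fromBlocks, complexify_fromBlocks]
  congr 1
  simp only [signature, fromBlocks_multiply]
  congr 1
  · simp [complexify_zero]
  · simp
  · ext; simp
  · simp [complexify_zero]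

theorem laxY_anticomm (F : Matrix (Fin p) (Fin q) ℝ) (c : ℂ) :
    laxY F c * signature p q = -(signature p q * laxY F c) := by
  rw [laxY_eq, smul_mul_assoc, mul_smul_comm, Matrix.mul_assoc, laxS_anticomm, Matrix.mul_neg,
    smul_neg]

theorem transpose_laxY (F : Matrix (Fin p) (Fin q) ℝ) (c : ℂ) : (laxY F c)ᵀ = -laxY F c := by
  rw [laxY_eq, transpose_smul, transpose_mul, transpose_laxS, transpose_signature,
    laxS_anticomm, smul_neg]

/-- Here `laxS` serves only as the symmetric off-diagonal embedding, applied to `A` instead of `F`;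
all dependence on the point is moved into the frame. -/
theorem laxA_eq (A : Matrix (Fin p) (Fin q) ℝ) (x : PhaseSpace p q) :
    laxA A x = frame x * laxS A * (frame x)ᵀ := by
  rw [frame_eq, laxS, ← complexify_transpose, ← complexify_mul, ← complexify_mul,
    fromBlocks_transpose, fromBlocks_multiply, fromBlocks_multiply, laxA]
  simp

theorem laxL_eq (x : PhaseSpace p q) :
    laxL x = -(frame x * momentum x * (frame x)ᵀ) := by
  rw [frame_eq, momentum_eq, ← complexify_transpose, ← complexify_mul, ← complexify_mul,
    fromBlocks_transpose, fromBlocks_multiply, fromBlocks_multiply, laxL, complexify_neg]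
  simp

theorem transpose_frame_comm_signature (x : PhaseSpace p q) :
    (frame x)ᵀ * signature p q = signature p q * (frame x)ᵀ := by
  have := congrArg transpose (frame_comm_signature x)
  simpa [transpose_mul, transpose_signature] using this.symm

theorem frame_conj_comm {X : BlockMatrix p q} (x : PhaseSpace p q)
    (hX : X * signature p q = signature p q * X) :
    frame x * X * (frame x)ᵀ * signature p q = signature p q * (frame x * X * (frame x)ᵀ) := by
  rw [Matrix.mul_assoc, transpose_frame_comm_signature, ← Matrix.mul_assoc, Matrix.mul_assoc _ X,
    hX, ← Matrix.mul_assoc, frame_comm_signature]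
  simp only [Matrix.mul_assoc]

theorem frame_conj_anticomm {X : BlockMatrix p q} (x : PhaseSpace p q)
    (hX : X * signature p q = -(signature p q * X)) :
    frame x * X * (frame x)ᵀ * signature p q = -(signature p q * (frame x * X * (frame x)ᵀ)) := by
  rw [Matrix.mul_assoc, transpose_frame_comm_signature, ← Matrix.mul_assoc, Matrix.mul_assoc _ X,
    hX, Matrix.mul_neg, ← Matrix.mul_assoc, frame_comm_signature]
  simp only [Matrix.mul_assoc, Matrix.neg_mul]

theorem laxA_anticomm (A : Matrix (Fin p) (Fin q) ℝ) (x : PhaseSpace p q) :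
    laxA A x * signature p q = -(signature p q * laxA A x) := by
  rw [laxA_eq]; exact frame_conj_anticomm x (laxS_anticomm A)

theorem transpose_laxA (A : Matrix (Fin p) (Fin q) ℝ) (x : PhaseSpace p q) :
    (laxA A x)ᵀ = laxA A x := by
  simp only [laxA_eq, transpose_mul, transpose_transpose, transpose_laxS, Matrix.mul_assoc]

theorem laxL_comm (x : PhaseSpace p q) :
    laxL x * signature p q = signature p q * laxL x := by
  rw [laxL_eq, Matrix.neg_mul, Matrix.mul_neg, frame_conj_comm x (momentum_comm_signature x)]

theorem transpose_laxL (x : PhaseSpace p q) : (laxL x)ᵀ = -laxL x := by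
  simp only [laxL_eq, transpose_neg, transpose_mul, transpose_transpose, transpose_momentum,
    Matrix.mul_assoc, Matrix.neg_mul, Matrix.mul_neg]

theorem laxL'_comm (A F : Matrix (Fin p) (Fin q) ℝ) (c : ℂ) (x : PhaseSpace p q) :
    laxL' A F c x * signature p q = signature p q * laxL' A F c x := by
  have ha := laxA_anticomm A x
  have hy := laxY_anticomm F c
  have e1 : laxY F c * laxA A x * signature p q = signature p q * (laxY F c * laxA A x) := by
    rw [Matrix.mul_assoc, ha, Matrix.mul_neg, ← Matrix.mul_assoc, hy, Matrix.neg_mul, neg_neg,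
      Matrix.mul_assoc]
  have e2 : laxA A x * laxY F c * signature p q = signature p q * (laxA A x * laxY F c) := by
    rw [Matrix.mul_assoc, hy, Matrix.mul_neg, ← Matrix.mul_assoc, ha, Matrix.neg_mul, neg_neg,
      Matrix.mul_assoc]
  simp only [laxL', Matrix.sub_mul, Matrix.mul_sub, smul_mul_assoc, mul_smul_comm, Matrix.add_mul,
    Matrix.mul_add, e1, e2, laxL_comm]

theorem transpose_laxL' (A F : Matrix (Fin p) (Fin q) ℝ) (c : ℂ) (x : PhaseSpace p q) :
    (laxL' A F c x)ᵀ = -laxL' A F c x := by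
  simp only [laxL', transpose_sub, transpose_smul, transpose_add, transpose_mul, transpose_laxL,
    transpose_laxA, transpose_laxY, Matrix.mul_neg, Matrix.neg_mul]
  module

end Frames

/-! ### Derivatives of the Lax matrix along curves in the phase space. -/

section Calculus

open Matrix
open scoped Matrix.Norms.Operator

variable {p q : ℕ}

/-- The embedding `X ↦ diag(X, 0)` as a real linear map. -/
def blockLeft (p q : ℕ) : Matrix (Fin p) (Fin p) ℝ →ₗ[ℝ] BlockMatrix p q where
  toFun X := fromBlocks (complexify X) 0 0 0
  map_add' X Y := by
    rw [fromBlocks_add]; congr 1 <;> first | simp | (ext; simp [complexify])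
  map_smul' a X := by
    rw [RingHom.id_apply, fromBlocks_smul]; congr 1 <;> first | simp | (ext; simp [complexify])

/-- The embedding `X ↦ diag(0, X)` as a real linear map. -/
def blockRight (p q : ℕ) : Matrix (Fin q) (Fin q) ℝ →ₗ[ℝ] BlockMatrix p q where
  toFun X := fromBlocks 0 0 0 (complexify X)
  map_add' X Y := by
    rw [fromBlocks_add]; congr 1 <;> first | simp | (ext; simp [complexify])
  map_smul' a X := by
    rw [RingHom.id_apply, fromBlocks_smul]; congr 1 <;> first | simp | (ext; simp [complexify])

theorem hasDerivAt_linearMap_comp {n : ℕ} (T : Matrix (Fin n) (Fin n) ℝ →ₗ[ℝ] BlockMatrix p q)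
    {X : ℝ → Matrix (Fin n) (Fin n) ℝ} {X' : Matrix (Fin n) (Fin n) ℝ} {t : ℝ}
    (h : HasDerivAt X X' t) : HasDerivAt (fun t => T (X t)) (T X') t :=
  T.toContinuousLinearMap.hasFDerivAt.comp_hasDerivAt t h

theorem hasDerivAt_exp_smul {n : ℕ} (Z : Matrix (Fin n) (Fin n) ℝ) :
    HasDerivAt (fun t : ℝ => NormedSpace.exp (t • Z)) Z 0 :=
  (hasDerivAt_exp_smul_const (𝕂 := ℝ) Z (0 : ℝ)).congr_deriv (by simp)

theorem hasDerivAt_add_smul {n : ℕ} (X Z : Matrix (Fin n) (Fin n) ℝ) :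
    HasDerivAt (fun t : ℝ => X + t • Z) Z 0 :=
  (((hasDerivAt_id (0 : ℝ)).smul_const Z).const_add X).congr_deriv (by simp)

theorem hasDerivAt_frame_k (x : PhaseSpace p q) (Z : LieSO p) :
    HasDerivAt (fun t : ℝ => frame { x with k := x.k * expSO (t • Z) })
      (frame x * blockLeft p q Z.1) 0 := by
  -- The moving frame is `frame x * diag(exp(tZ), 1)`, and `diag(exp(tZ), 1)` is affine in
  -- `exp(tZ)`.
  have h := ((hasDerivAt_linearMap_comp (blockLeft p q) (hasDerivAt_exp_smul Z.1)).add_const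
    (fromBlocks 0 0 0 1)).const_mul (frame x)
  refine h.congr_of_eventuallyEq (Filter.Eventually.of_forall fun t => ?_)
  simp [frame, blockLeft, fromBlocks_add, fromBlocks_multiply, expSO, complexify_mul]

theorem hasDerivAt_frame_r (x : PhaseSpace p q) (Z : LieSO q) :
    HasDerivAt (fun t : ℝ => frame { x with r := x.r * expSO (t • Z) })
      (frame x * blockRight p q Z.1) 0 := by
  have h := ((hasDerivAt_linearMap_comp (blockRight p q) (hasDerivAt_exp_smul Z.1)).add_const
    (fromBlocks 1 0 0 0)).const_mul (frame x)
  refine h.congr_of_eventuallyEq (Filter.Eventually.of_forall fun t => ?_)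
  simp [frame, blockRight, fromBlocks_add, fromBlocks_multiply, expSO, complexify_mul]

theorem hasDerivAt_momentum_l (x : PhaseSpace p q) (Z : LieSO p) :
    HasDerivAt (fun t : ℝ => momentum { x with l := x.l + t • Z }) (blockLeft p q Z.1) 0 := by
  have h := (hasDerivAt_linearMap_comp (blockLeft p q) (hasDerivAt_add_smul x.l.1 Z.1)).add_const
    (fromBlocks 0 0 0 (complexify x.m.1))
  refine h.congr_of_eventuallyEq (Filter.Eventually.of_forall fun t => ?_)
  simp [momentum, blockLeft, fromBlocks_add]

theorem hasDerivAt_momentum_m (x : PhaseSpace p q) (Z : LieSO q) :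
    HasDerivAt (fun t : ℝ => momentum { x with m := x.m + t • Z }) (blockRight p q Z.1) 0 := by
  have h := (hasDerivAt_linearMap_comp (blockRight p q) (hasDerivAt_add_smul x.m.1 Z.1)).add_const
    (fromBlocks (complexify x.l.1) 0 0 0)
  refine h.congr_of_eventuallyEq (Filter.Eventually.of_forall fun t => ?_)
  simp [momentum, blockRight, fromBlocks_add]

/-- An infinitesimal rotation `Z` of the frame acts on `a` and `l` by the commutator with its
conjugate `W`, and a momentum variation `N` shifts `l` by the conjugate of `-N`. The factor `(1 -
λ⁻¹y)⁻¹` is constant on the phase space. -/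
theorem hasDerivAt_deformedLax (A F : Matrix (Fin p) (Fin q) ℝ) (c lam : ℂ) {γ : ℝ → PhaseSpace p q}
    {x : PhaseSpace p q} (hx : γ 0 = x) {Z N : BlockMatrix p q} (hZ : Zᵀ = -Z)
    (hf : HasDerivAt (fun t => frame (γ t)) (frame x * Z) 0)
    (hm : HasDerivAt (fun t => momentum (γ t)) N 0) {W : BlockMatrix p q}
    (hW : W = frame x * Z * (frame x)ᵀ) :
    HasDerivAt (fun t => deformedLax A F c lam (γ t))
      ((1 - lam⁻¹ • laxY F c)⁻¹ * (
        (W * laxL x - laxL x * W - frame x * N * (frame x)ᵀ -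
        (1 / 2 : ℂ) • (laxY F c * (W * laxA A x - laxA A x * W) +
          (W * laxA A x - laxA A x * W) * laxY F c))
          + lam • (W * laxA A x - laxA A x * W))) 0 := by
  have hK : ∀ X, (frame x)ᵀ * (frame x * X) = X := fun X => by
    rw [← Matrix.mul_assoc, transpose_frame_mul_frame, Matrix.one_mul]
  have hft : HasDerivAt (fun t => (frame (γ t))ᵀ) (-(Z * (frame x)ᵀ)) 0 := by
    refine ((transposeLinearEquiv (Fin p ⊕ Fin q) (Fin p ⊕ Fin q) ℝ
      ℂ).toLinearMap.toContinuousLinearMap.hasFDerivAt.comp_hasDerivAt (0 : ℝ) hf).congr_deriv ?_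
    change (frame x * Z)ᵀ = _
    rw [transpose_mul, hZ, Matrix.neg_mul]
  have ha : HasDerivAt (fun t => laxA A (γ t)) (W * laxA A x - laxA A x * W) 0 := by
    simp only [laxA_eq]
    refine ((hf.mul_const (laxS A)).mul hft).congr_deriv ?_
    rw [hx, hW]
    simp only [Matrix.mul_assoc, hK, Matrix.mul_neg, sub_eq_add_neg]
  have hl : HasDerivAt (fun t => laxL (γ t))
      (W * laxL x - laxL x * W - frame x * N * (frame x)ᵀ) 0 := by
    simp only [laxL_eq]
    refine ((hf.mul hm).mul hft).neg.congr_deriv ?_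
    rw [hW]
    simp only [Pi.mul_apply, hx, Matrix.mul_assoc, hK, Matrix.mul_neg, Matrix.neg_mul,
      Matrix.add_mul]
    abel
  have h := ((hl.sub (((ha.const_mul (laxY F c)).add
    (ha.mul_const (laxY F c))).const_smul (1 / 2 : ℂ))).add (ha.const_smul lam)).add_const
      (lam⁻¹ • laxS F) |>.const_mul ((1 - lam⁻¹ • laxY F c)⁻¹)
  refine h.congr_of_eventuallyEq (Filter.Eventually.of_forall fun t => ?_)
  dsimp only
  rw [deformedLax, laxL', add_comm (lam • _)]
  rfl

end Calculus

/-! ### Gradients of cyclic functions of the Lax matrix. -/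

section Gradient

open Matrix
open scoped Matrix.Norms.Operator

variable {p q : ℕ}

theorem exists_trace_representation {ι : Type*} [Fintype ι] [DecidableEq ι]
    (T : Matrix ι ι ℂ →ₗ[ℂ] ℂ) : ∃ M : Matrix ι ι ℂ, ∀ N, T N = trace (M * N) := by
  -- The indices are swapped because `tr(M E_{ji}) = M_{ij}`.
  refine ⟨of fun i j => T (single j i 1), fun N => ?_⟩
  conv_lhs => rw [matrix_eq_sum_single N]
  simp only [map_sum, trace, diag, mul_apply, of_apply]
  rw [Finset.sum_comm]
  refine Finset.sum_congr rfl fun i _ => Finset.sum_congr rfl fun j _ => ?_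
  have : single j i (N j i) = N j i • single j i (1 : ℂ) := by simp
  rw [this, map_smul, smul_eq_mul, mul_comm]

/-- Differentiate `φ(L(1 + tZ)) = φ((1 + tZ)L)` at `t = 0`; no invertibility of `L` is needed. -/
theorem fderiv_mul_comm {φ : BlockMatrix p q → ℂ} (hd : Differentiable ℂ φ)
    (hcyc : ∀ X Y, φ (X * Y) = φ (Y * X)) (L Z : BlockMatrix p q) :
    fderiv ℂ φ L (L * Z) = fderiv ℂ φ L (Z * L) := by
  have h : ∀ N, HasDerivAt (fun t : ℂ => φ (L + t • N)) (fderiv ℂ φ L N) 0 := fun N => by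
    have h1 : HasDerivAt (fun t : ℂ => L + t • N) N 0 :=
      (((hasDerivAt_id (0 : ℂ)).smul_const N).const_add L).congr_deriv (by simp)
    have h2 : HasFDerivAt φ (fderiv ℂ φ L) (L + (0 : ℂ) • N) := by
      simpa using (hd L).hasFDerivAt
    exact h2.comp_hasDerivAt (0 : ℂ) h1
  have e : (fun t : ℂ => φ (L + t • (L * Z))) = fun t : ℂ => φ (L + t • (Z * L)) := by
    funext t
    have := hcyc L (1 + t • Z)
    simpa [Matrix.mul_add, Matrix.add_mul] using this
  have h1 := h (L * Z)
  rw [e] at h1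
  exact h1.unique (h (Z * L))

/-- `V` and `O` are the two components of `U = M D⁻¹`, with `M` the trace-form gradient of `φ`.
Absorbing `D⁻¹` into `U` pairs it directly with variations of `λa + l'`, and makes the commutation
of `M` with the Lax matrix polynomial in `y`. -/
theorem exists_gradient {φ : BlockMatrix p q → ℂ} (hd : Differentiable ℂ φ)
    (hcyc : ∀ X Y, φ (X * Y) = φ (Y * X)) (A F : Matrix (Fin p) (Fin q) ℝ) {c lam : ℂ}
    (hreg : IsRegular F c lam) (x : PhaseSpace p q) :
    ∃ V O : BlockMatrix p q, V * signature p q = signature p q * V ∧ Vᵀ = -V ∧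
      O * signature p q = -(signature p q * O) ∧
      lam • (lam • (V * laxL' A F c x - laxL' A F c x * V) +
        (O * (lam ^ 2 • laxA A x + laxS F) - (lam ^ 2 • laxA A x + laxS F) * O)) =
        laxY F c * (V * (lam ^ 2 • laxA A x + laxS F) + lam • (O * laxL' A F c x)) -
          ((lam ^ 2 • laxA A x + laxS F) * V + lam • (laxL' A F c x * O)) * laxY F c ∧
      lam • ((V * (lam ^ 2 • laxA A x + laxS F) - (lam ^ 2 • laxA A x + laxS F) * V) +
        lam • (O * laxL' A F c x - laxL' A F c x * O)) =
        laxY F c * (lam • (V * laxL' A F c x) + O * (lam ^ 2 • laxA A x + laxS F)) -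
          (lam • (laxL' A F c x * V) + (lam ^ 2 • laxA A x + laxS F) * O) * laxY F c ∧
      ∀ E C : BlockMatrix p q, E * signature p q = signature p q * E → Eᵀ = -E →
        C * signature p q = -(signature p q * C) → Cᵀ = C →
        fderiv ℂ φ (deformedLax A F c lam x) ((1 - lam⁻¹ • laxY F c)⁻¹ * (E + C)) =
          trace (V * E) + trace (O * C) := by
  obtain ⟨hlam, hunit⟩ := hreg
  have hdet := (isUnit_iff_isUnit_det _).1 hunit
  set D := 1 - lam⁻¹ • laxY F c with hD
  set T := lam ^ 2 • laxA A x + laxS F with hT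
  set l := laxL' A F c x with hl
  set y := laxY F c with hy
  have hL : deformedLax A F c lam x = D⁻¹ * (lam⁻¹ • (T + lam • l)) := by
    rw [deformedLax]
    congr 1
    rw [hT, smul_add, smul_add, smul_smul, smul_smul, inv_mul_cancel₀ hlam, one_smul, pow_two,
      inv_mul_cancel_left₀ hlam]
    abel
  obtain ⟨M, hM⟩ := exists_trace_representation (fderiv ℂ φ (deformedLax A F c lam x)).toLinearMap
  -- Cyclicity of `φ` together with nondegeneracy of the trace form.
  have hcomm : M * deformedLax A F c lam x = deformedLax A F c lam x * M := by
    refine ext_iff_trace_mul_right.2 fun Z => ?_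
    have h1 := fderiv_mul_comm hd hcyc (deformedLax A F c lam x) Z
    have h2 := hM (deformedLax A F c lam x * Z)
    have h3 := hM (Z * deformedLax A F c lam x)
    rw [ContinuousLinearMap.coe_coe] at h2 h3
    rw [Matrix.mul_assoc, ← h2, h1, h3, ← Matrix.mul_assoc, trace_mul_comm, Matrix.mul_assoc]
  set U := M * D⁻¹ with hU
  have hDD : D * D⁻¹ = 1 := mul_nonsing_inv _ hdet
  have hDD' : D⁻¹ * D = 1 := nonsing_inv_mul _ hdet
  have hrel : D * (U * (T + lam • l)) = (T + lam • l) * U * D := by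
    have h1 : M * (D⁻¹ * (T + lam • l)) = D⁻¹ * (T + lam • l) * M := by
      rw [hL] at hcomm
      simp only [mul_smul_comm, smul_mul_assoc] at hcomm
      exact smul_right_injective _ (inv_ne_zero hlam) hcomm
    rw [hU, Matrix.mul_assoc, h1, ← Matrix.mul_assoc, ← Matrix.mul_assoc, hDD, Matrix.one_mul,
      Matrix.mul_assoc, Matrix.mul_assoc, hDD', Matrix.mul_one]
  have hrel' : lam • (U * (T + lam • l) - (T + lam • l) * U) =
      y * U * (T + lam • l) - (T + lam • l) * U * y := by
    rw [hD, Matrix.sub_mul, Matrix.mul_sub, Matrix.one_mul, Matrix.mul_one, smul_mul_assoc,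
      mul_smul_comm] at hrel
    have h2 : U * (T + lam • l) - (T + lam • l) * U =
        lam⁻¹ • (y * (U * (T + lam • l)) - (T + lam • l) * U * y) := by
      rw [smul_sub]
      linear_combination (norm := module) hrel
    rw [h2, smul_smul, mul_inv_cancel₀ hlam, one_smul, Matrix.mul_assoc y]
  have hTJ : T * signature p q = -(signature p q * T) := by
    rw [hT, Matrix.add_mul, Matrix.mul_add, smul_mul_assoc, mul_smul_comm, laxA_anticomm,
      laxS_anticomm, smul_neg, neg_add]
  have hTt : Tᵀ = T := by
    rw [hT, transpose_add, transpose_smul, transpose_laxA, transpose_laxS]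
  obtain ⟨he, ho⟩ := parity_parts_relation hTJ hTt (laxL'_comm A F c x) (transpose_laxL' A F c x)
    (laxY_anticomm F c) (transpose_laxY F c) hrel'
  refine ⟨evenPart (signature p q) U, oddPart (signature p q) U,
    evenPart_comm signature_mul_self U, transpose_evenPart transpose_signature U,
    oddPart_anticomm signature_mul_self U, he, ho, fun E C hE hEt hC hCt => ?_⟩
  have h1 := hM (D⁻¹ * (E + C))
  rw [ContinuousLinearMap.coe_coe] at h1
  rw [h1, trace_evenPart_mul signature_mul_self hE hEt, trace_oddPart_mul signature_mul_self hC hCt,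
    ← Matrix.mul_assoc, Matrix.mul_add, trace_add]

/-- The gradient in the configuration variables obtained from the parity components `V`, `O`. -/
def configGradient (A F : Matrix (Fin p) (Fin q) ℝ) (c lam : ℂ) (x : PhaseSpace p q)
    (V O : BlockMatrix p q) : BlockMatrix p q :=
  let B := lam • O - (1 / 2 : ℂ) • (V * laxY F c + laxY F c * V)
  laxA A x * B - B * laxA A x + (laxL x * V - V * laxL x)

theorem deriv_comp_deformedLax {φ : BlockMatrix p q → ℂ} (hd : Differentiable ℂ φ)
    (A F : Matrix (Fin p) (Fin q) ℝ) (c lam : ℂ) {γ : ℝ → PhaseSpace p q}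
    {x : PhaseSpace p q} (hx : γ 0 = x) {Z N : BlockMatrix p q} (hZ : Zᵀ = -Z)
    (hf : HasDerivAt (fun t => frame (γ t)) (frame x * Z) 0)
    (hm : HasDerivAt (fun t => momentum (γ t)) N 0) {W : BlockMatrix p q}
    (hW : W = frame x * Z * (frame x)ᵀ) :
    deriv (fun t => φ (deformedLax A F c lam (γ t))) 0 =
      fderiv ℂ φ (deformedLax A F c lam x) ((1 - lam⁻¹ • laxY F c)⁻¹ * (
        (W * laxL x - laxL x * W - frame x * N * (frame x)ᵀ -
        (1 / 2 : ℂ) • (laxY F c * (W * laxA A x - laxA A x * W) +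
          (W * laxA A x - laxA A x * W) * laxY F c))
          + lam • (W * laxA A x - laxA A x * W))) := by
  have h := hasDerivAt_deformedLax A F c lam hx hZ hf hm hW
  have h2 : HasFDerivAt φ ((fderiv ℂ φ (deformedLax A F c lam x)).restrictScalars ℝ)
      (deformedLax A F c lam (γ 0)) := by
    rw [hx]; exact (hd _).hasFDerivAt.restrictScalars ℝ
  exact (h2.comp_hasDerivAt (0 : ℝ) h).deriv

/-- Since `l' = l - ½(ya + ay)`, the variation `[W, a]` is paired with `B = λO - ½(Vy + yV)` and the
variation `[W, l]` with `V`. Moving `W` out of the commutators gives `[a, B] + [l, V]`, which is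
`configGradient`. -/
theorem deriv_comp_deformedLax_eq_trace {φ : BlockMatrix p q → ℂ} (hd : Differentiable ℂ φ)
    (A F : Matrix (Fin p) (Fin q) ℝ) (c lam : ℂ) {γ : ℝ → PhaseSpace p q}
    {x : PhaseSpace p q} (hx : γ 0 = x) {Z N V O : BlockMatrix p q} (hZ : Zᵀ = -Z)
    (hZJ : Z * signature p q = signature p q * Z) (hN : Nᵀ = -N)
    (hNJ : N * signature p q = signature p q * N)
    (hf : HasDerivAt (fun t => frame (γ t)) (frame x * Z) 0)
    (hm : HasDerivAt (fun t => momentum (γ t)) N 0)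
    (hgrad : ∀ E C : BlockMatrix p q, E * signature p q = signature p q * E → Eᵀ = -E →
      C * signature p q = -(signature p q * C) → Cᵀ = C →
      fderiv ℂ φ (deformedLax A F c lam x) ((1 - lam⁻¹ • laxY F c)⁻¹ * (E + C)) =
        trace (V * E) + trace (O * C)) :
    deriv (fun t => φ (deformedLax A F c lam (γ t))) 0 =
      trace ((frame x)ᵀ * configGradient A F c lam x V O * frame x * Z) -
        trace ((frame x)ᵀ * V * frame x * N) := by
  rw [deriv_comp_deformedLax hd A F c lam hx hZ hf hm rfl]
  have hWJ := frame_conj_comm x hZJ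
  have hWt : (frame x * Z * (frame x)ᵀ)ᵀ = -(frame x * Z * (frame x)ᵀ) := by
    simp only [transpose_mul, transpose_transpose, hZ, Matrix.mul_assoc, Matrix.neg_mul,
      Matrix.mul_neg]
  have hNJ' := frame_conj_comm x hNJ
  have hNt : (frame x * N * (frame x)ᵀ)ᵀ = -(frame x * N * (frame x)ᵀ) := by
    simp only [transpose_mul, transpose_transpose, hN, Matrix.mul_assoc, Matrix.neg_mul,
      Matrix.mul_neg]
  have tZ : trace ((frame x)ᵀ * configGradient A F c lam x V O * frame x * Z) =
      trace (configGradient A F c lam x V O * (frame x * Z * (frame x)ᵀ)) := by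
    rw [Matrix.mul_assoc, Matrix.mul_assoc, trace_mul_comm]; simp only [Matrix.mul_assoc]
  have tN : trace ((frame x)ᵀ * V * frame x * N) =
      trace (V * (frame x * N * (frame x)ᵀ)) := by
    rw [Matrix.mul_assoc, Matrix.mul_assoc, trace_mul_comm]; simp only [Matrix.mul_assoc]
  rw [tZ, tN]
  generalize frame x * Z * (frame x)ᵀ = W at *
  generalize frame x * N * (frame x)ᵀ = N' at *
  have haJ := laxA_anticomm A x
  have hat := transpose_laxA A x
  have hlJ := laxL_comm x
  have hlt := transpose_laxL x
  have hyJ := laxY_anticomm F c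
  have hyt := transpose_laxY F c
  rw [configGradient]
  generalize laxA A x = a at *
  generalize laxL x = l at *
  generalize laxY F c = y at *
  generalize signature p q = J at *
  have hW' : ∀ X, W * (J * X) = J * (W * X) := fun X => by
    rw [← Matrix.mul_assoc, hWJ, Matrix.mul_assoc]
  have hl' : ∀ X, l * (J * X) = J * (l * X) := fun X => by
    rw [← Matrix.mul_assoc, hlJ, Matrix.mul_assoc]
  have ha' : ∀ X, a * (J * X) = -(J * (a * X)) := fun X => by
    rw [← Matrix.mul_assoc, haJ, Matrix.neg_mul, Matrix.mul_assoc]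
  have hy' : ∀ X, y * (J * X) = -(J * (y * X)) := fun X => by
    rw [← Matrix.mul_assoc, hyJ, Matrix.neg_mul, Matrix.mul_assoc]
  -- `E` is the variation of `l'` and `C` is `λ` times that of `a`; the four side goals are their
  -- symmetry types.
  rw [hgrad]
  · simp only [Matrix.mul_add, Matrix.add_mul, Matrix.mul_sub, Matrix.sub_mul, trace_add,
      trace_sub, trace_smul, smul_mul_assoc, mul_smul_comm, Matrix.mul_assoc, smul_eq_mul]
    simp only [trace_cycle₃ a, trace_cycle₃ l, trace_cycle₃ y, Matrix.mul_assoc]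
    ring
  · simp only [Matrix.mul_add, Matrix.add_mul, Matrix.mul_sub, Matrix.sub_mul, smul_mul_assoc,
      mul_smul_comm, Matrix.mul_assoc, hWJ, hlJ, haJ, hyJ, hNJ', hW', hl', ha', hy',
      Matrix.mul_neg, neg_neg]
  · simp only [transpose_add, transpose_sub, transpose_smul, transpose_mul, hWt, hlt, hat, hyt,
      hNt, Matrix.mul_sub, Matrix.sub_mul, Matrix.mul_neg,
      Matrix.neg_mul, Matrix.mul_assoc]
    module
  · simp only [Matrix.mul_sub, Matrix.sub_mul, smul_mul_assoc,
      mul_smul_comm, Matrix.mul_assoc, hWJ, haJ, hW', ha', Matrix.mul_neg]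
    module
  · simp only [transpose_sub, transpose_smul, transpose_mul, hWt, hat, Matrix.mul_neg,
      Matrix.neg_mul]
    module

end Gradient

/-! ### The Poisson bracket in trace form and its vanishing for `λ² ≠ μ²`. -/

section Involution

open Matrix
open scoped Matrix.Norms.Operator

variable {p q : ℕ}

theorem blockLeft_comm_signature (X : Matrix (Fin p) (Fin p) ℝ) :
    blockLeft p q X * signature p q = signature p q * blockLeft p q X := by
  simp [blockLeft, signature, fromBlocks_multiply]

theorem blockRight_comm_signature (X : Matrix (Fin q) (Fin q) ℝ) :
    blockRight p q X * signature p q = signature p q * blockRight p q X := by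
  simp [blockRight, signature, fromBlocks_multiply]

theorem transpose_blockLeft (Z : LieSO p) : (blockLeft p q Z.1)ᵀ = -blockLeft p q Z.1 := by
  simp [blockLeft, fromBlocks_transpose, fromBlocks_neg, ← complexify_transpose, transpose_LieSO,
    complexify_neg]

theorem transpose_blockRight (Z : LieSO q) : (blockRight p q Z.1)ᵀ = -blockRight p q Z.1 := by
  simp [blockRight, fromBlocks_transpose, fromBlocks_neg, ← complexify_transpose, transpose_LieSO,
    complexify_neg]

theorem trace_fromBlocks {m n : Type*} [Fintype m] [Fintype n] (a : Matrix m m ℂ)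
    (b : Matrix m n ℂ) (c : Matrix n m ℂ) (d : Matrix n n ℂ) :
    trace (fromBlocks a b c d) = trace a + trace d := by
  simp [trace, Fintype.sum_sum_type]

theorem trace_mul_blockLeft (X : BlockMatrix p q) (Z : Matrix (Fin p) (Fin p) ℝ) :
    trace (X * blockLeft p q Z) = trace (X.toBlocks₁₁ * complexify Z) := by
  conv_lhs => rw [← fromBlocks_toBlocks X]
  simp [blockLeft, fromBlocks_multiply, trace_fromBlocks]

theorem trace_mul_blockRight (X : BlockMatrix p q) (Z : Matrix (Fin q) (Fin q) ℝ) :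
    trace (X * blockRight p q Z) = trace (X.toBlocks₂₂ * complexify Z) := by
  conv_lhs => rw [← fromBlocks_toBlocks X]
  simp [blockRight, fromBlocks_multiply, trace_fromBlocks]

theorem exists_eq_fromBlocks_of_comm {X : BlockMatrix p q}
    (hX : X * signature p q = signature p q * X) :
    X = fromBlocks X.toBlocks₁₁ 0 0 X.toBlocks₂₂ := by
  rw [← fromBlocks_toBlocks X] at hX
  simp only [signature, fromBlocks_multiply, fromBlocks_inj] at hX
  obtain ⟨-, h1, h2, -⟩ := hX
  conv_lhs => rw [← fromBlocks_toBlocks X]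
  have h1' : X.toBlocks₁₂ = 0 := by
    simp only [Matrix.mul_zero, Matrix.mul_neg, Matrix.mul_one, zero_add, Matrix.one_mul,
      Matrix.zero_mul, add_zero] at h1
    ext i j; exact self_eq_neg.1 (congrFun (congrFun h1.symm i) j)
  have h2' : X.toBlocks₂₁ = 0 := by
    simp only [Matrix.mul_zero, Matrix.neg_mul, Matrix.mul_one, zero_add, Matrix.one_mul,
      Matrix.zero_mul, add_zero] at h2
    ext i j; exact self_eq_neg.1 (congrFun (congrFun h2 i) j)
  rw [h1', h2']

theorem update_l_zero (x : PhaseSpace p q) (Z : LieSO p) :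
    ({ x with l := x.l + (0 : ℝ) • Z } : PhaseSpace p q) = x := by
  ext1 <;> simp

theorem update_m_zero (x : PhaseSpace p q) (Z : LieSO q) :
    ({ x with m := x.m + (0 : ℝ) • Z } : PhaseSpace p q) = x := by
  ext1 <;> simp

theorem expSO_zero {n : ℕ} : expSO (0 : LieSO n) = 1 := by
  ext1
  simp [expSO]

theorem update_k_zero (x : PhaseSpace p q) (Z : LieSO p) :
    ({ x with k := x.k * expSO ((0 : ℝ) • Z) } : PhaseSpace p q) = x := by
  ext1 <;> simp [expSO_zero]

theorem update_r_zero (x : PhaseSpace p q) (Z : LieSO q) :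
    ({ x with r := x.r * expSO ((0 : ℝ) • Z) } : PhaseSpace p q) = x := by
  ext1 <;> simp [expSO_zero]

theorem hasDerivAt_frame_const (x : PhaseSpace p q) :
    HasDerivAt (fun _ : ℝ => frame x) (frame x * (0 : BlockMatrix p q)) 0 :=
  (hasDerivAt_const (0 : ℝ) (frame x)).congr_deriv (Matrix.mul_zero _).symm

/-- The Poisson bracket of two functions whose gradients are given by even and odd components. -/
theorem poissonBracket_eq_trace {f g : PhaseSpace p q → ℂ} {x : PhaseSpace p q}
    {V G V' G' : BlockMatrix p q}
    (hVJ : V * signature p q = signature p q * V) (hVt : Vᵀ = -V)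
    (hVJ' : V' * signature p q = signature p q * V') (hVt' : V'ᵀ = -V')
    (hl : ∀ i j, dEll f x i j = -trace ((frame x)ᵀ * V * frame x * blockLeft p q (gen i j).1))
    (hm : ∀ i j, dEm f x i j = -trace ((frame x)ᵀ * V * frame x * blockRight p q (gen i j).1))
    (hk : ∀ i j, dK f x i j = trace ((frame x)ᵀ * G * frame x * blockLeft p q (gen i j).1))
    (hr : ∀ i j, dR f x i j = trace ((frame x)ᵀ * G * frame x * blockRight p q (gen i j).1))
    (hl' : ∀ i j, dEll g x i j = -trace ((frame x)ᵀ * V' * frame x * blockLeft p q (gen i j).1))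
    (hm' : ∀ i j, dEm g x i j = -trace ((frame x)ᵀ * V' * frame x * blockRight p q (gen i j).1))
    (hk' : ∀ i j, dK g x i j = trace ((frame x)ᵀ * G' * frame x * blockLeft p q (gen i j).1))
    (hr' : ∀ i j, dR g x i j = trace ((frame x)ᵀ * G' * frame x * blockRight p q (gen i j).1)) :
    poissonBracket f g x =
      2 * (trace (V * G') - trace (V' * G) + trace (laxL x * (V * V' - V' * V))) := by
  have hK : ∀ X, frame x * ((frame x)ᵀ * X) = X := fun X => by
    rw [← Matrix.mul_assoc, frame_mul_transpose_frame, Matrix.one_mul]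
  have skew : ∀ X : BlockMatrix p q, Xᵀ = -X →
      ((frame x)ᵀ * X * frame x)ᵀ = -((frame x)ᵀ * X * frame x) := fun X hX => by
    simp only [transpose_mul, transpose_transpose, hX, Matrix.mul_assoc, Matrix.neg_mul,
      Matrix.mul_neg]
  have comm : ∀ X : BlockMatrix p q, X * signature p q = signature p q * X →
      (frame x)ᵀ * X * frame x * signature p q = signature p q * ((frame x)ᵀ * X * frame x) :=
    fun X hX => by
      rw [Matrix.mul_assoc, frame_comm_signature, ← Matrix.mul_assoc, Matrix.mul_assoc _ X, hX,
        ← Matrix.mul_assoc, transpose_frame_comm_signature]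
      simp only [Matrix.mul_assoc]
  have b := exists_eq_fromBlocks_of_comm (comm V hVJ)
  have b' := exists_eq_fromBlocks_of_comm (comm V' hVJ')
  have st : ∀ {X : BlockMatrix p q}, Xᵀ = -X → X.toBlocks₁₁ᵀ = -X.toBlocks₁₁ := fun h => by
    ext i j; exact congrFun (congrFun h (Sum.inl i)) (Sum.inl j)
  have st' : ∀ {X : BlockMatrix p q}, Xᵀ = -X → X.toBlocks₂₂ᵀ = -X.toBlocks₂₂ := fun h => by
    ext i j; exact congrFun (congrFun h (Sum.inr i)) (Sum.inr j)
  simp only [trace_mul_blockLeft] at hl hk hl' hk'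
  simp only [trace_mul_blockRight] at hm hr hm' hr'
  have s1 := sum_Ioi_bracket (transpose_LieSO x.l) (st (skew V hVt)) (st (skew V' hVt')) _ _
    hl hl' hk hk'
  have s2 := sum_Ioi_bracket (transpose_LieSO x.m) (st' (skew V hVt)) (st' (skew V' hVt')) _ _
    hm hm' hr hr'
  have tr2 : ∀ {X : BlockMatrix p q} (Y : BlockMatrix p q),
      X = fromBlocks X.toBlocks₁₁ 0 0 X.toBlocks₂₂ →
      trace (X.toBlocks₁₁ * Y.toBlocks₁₁) + trace (X.toBlocks₂₂ * Y.toBlocks₂₂) =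
        trace (X * Y) := fun {X} Y hX => by
    rw [hX, ← fromBlocks_toBlocks Y]
    simp [fromBlocks_multiply, trace_fromBlocks]
  have c1 := tr2 ((frame x)ᵀ * G' * frame x) b
  have c2 := tr2 ((frame x)ᵀ * G * frame x) b'
  have c3 : trace (complexify x.l.1 * ((frame x)ᵀ * V' * frame x).toBlocks₁₁ *
      ((frame x)ᵀ * V * frame x).toBlocks₁₁) +
      trace (complexify x.m.1 * ((frame x)ᵀ * V' * frame x).toBlocks₂₂ *
      ((frame x)ᵀ * V * frame x).toBlocks₂₂) =
      trace (momentum x * ((frame x)ᵀ * V' * frame x) * ((frame x)ᵀ * V * frame x)) := by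
    conv_rhs => rw [b, b']
    simp [momentum, fromBlocks_multiply, trace_fromBlocks]
  have conj : ∀ X Y : BlockMatrix p q, trace ((frame x)ᵀ * X * frame x *
      ((frame x)ᵀ * Y * frame x)) = trace (X * Y) := fun X Y => by
    rw [trace_mul_comm]
    simp only [Matrix.mul_assoc]
    rw [hK, trace_mul_comm]
    simp only [Matrix.mul_assoc]
    rw [frame_mul_transpose_frame, Matrix.mul_one, trace_mul_comm]
  have d3 : trace (momentum x * ((frame x)ᵀ * V' * frame x) * ((frame x)ᵀ * V * frame x)) =
      -trace (laxL x * V' * V) := by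
    rw [laxL_eq]
    simp only [Matrix.mul_assoc, Matrix.neg_mul, trace_neg, neg_neg]
    rw [hK, trace_mul_comm (frame x)]
    simp only [Matrix.mul_assoc]
  -- All three factors are skew, so transposition reverses the word with a sign; thus `tr(l[V,V'])`
  -- is twice a single trace, matching the coefficient in `sum_Ioi_bracket`.
  have d4 : trace (laxL x * V * V') = -trace (laxL x * V' * V) := by
    rw [← trace_transpose]
    simp only [transpose_mul, hVt, hVt', transpose_laxL, Matrix.neg_mul, Matrix.mul_neg, neg_neg,
      trace_neg]
    rw [← Matrix.mul_assoc, trace_mul_comm, Matrix.mul_assoc]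
  rw [conj] at c1 c2
  rw [d3] at c3
  rw [Matrix.mul_sub, trace_sub, ← Matrix.mul_assoc, ← Matrix.mul_assoc, d4, poissonBracket,
    ← c1, ← c2]
  linear_combination s1 + s2 + 4 * c3

theorem dEll_eq_trace {φ : BlockMatrix p q → ℂ} (hd : Differentiable ℂ φ)
    (A F : Matrix (Fin p) (Fin q) ℝ) (c lam : ℂ) (x : PhaseSpace p q) {V O : BlockMatrix p q}
    (hgrad : ∀ E C : BlockMatrix p q, E * signature p q = signature p q * E → Eᵀ = -E →
      C * signature p q = -(signature p q * C) → Cᵀ = C →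
      fderiv ℂ φ (deformedLax A F c lam x) ((1 - lam⁻¹ • laxY F c)⁻¹ * (E + C)) =
        trace (V * E) + trace (O * C)) :
    (∀ i j, dEll (fun x => φ (deformedLax A F c lam x)) x i j =
      -trace ((frame x)ᵀ * V * frame x * blockLeft p q (gen i j).1)) ∧
    (∀ i j, dEm (fun x => φ (deformedLax A F c lam x)) x i j =
      -trace ((frame x)ᵀ * V * frame x * blockRight p q (gen i j).1)) ∧
    (∀ i j, dK (fun x => φ (deformedLax A F c lam x)) x i j =
      trace ((frame x)ᵀ * configGradient A F c lam x V O * frame x *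
        blockLeft p q (gen i j).1)) ∧
    (∀ i j, dR (fun x => φ (deformedLax A F c lam x)) x i j =
      trace ((frame x)ᵀ * configGradient A F c lam x V O * frame x *
        blockRight p q (gen i j).1)) := by
  refine ⟨fun i j => ?_, fun i j => ?_, fun i j => ?_, fun i j => ?_⟩
  · refine (deriv_comp_deformedLax_eq_trace hd A F c lam
      (γ := fun t : ℝ => { x with l := x.l + t • gen i j }) (update_l_zero x (gen i j)) (Z := 0) (by simp)
      (by simp) (transpose_blockLeft (gen i j)) (blockLeft_comm_signature _) (hasDerivAt_frame_const x)
      (hasDerivAt_momentum_l x (gen i j)) hgrad).trans ?_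
    rw [Matrix.mul_zero, trace_zero, zero_sub]
  · refine (deriv_comp_deformedLax_eq_trace hd A F c lam
      (γ := fun t : ℝ => { x with m := x.m + t • gen i j }) (update_m_zero x (gen i j)) (Z := 0) (by simp)
      (by simp) (transpose_blockRight (gen i j)) (blockRight_comm_signature _) (hasDerivAt_frame_const x)
      (hasDerivAt_momentum_m x (gen i j)) hgrad).trans ?_
    rw [Matrix.mul_zero, trace_zero, zero_sub]
  · refine (deriv_comp_deformedLax_eq_trace hd A F c lam
      (γ := fun t : ℝ => { x with k := x.k * expSO (t • gen i j) }) (update_k_zero x (gen i j)) (N := 0)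
      (transpose_blockLeft (gen i j)) (blockLeft_comm_signature _) (by simp) (by simp)
      (hasDerivAt_frame_k x (gen i j)) (hasDerivAt_const (0 : ℝ) (momentum x)) hgrad).trans ?_
    rw [Matrix.mul_zero ((frame x)ᵀ * V * frame x), trace_zero, sub_zero]
  · refine (deriv_comp_deformedLax_eq_trace hd A F c lam
      (γ := fun t : ℝ => { x with r := x.r * expSO (t • gen i j) }) (update_r_zero x (gen i j)) (N := 0)
      (transpose_blockRight (gen i j)) (blockRight_comm_signature _) (by simp) (by simp)
      (hasDerivAt_frame_r x (gen i j)) (hasDerivAt_const (0 : ℝ) (momentum x)) hgrad).trans ?_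
    rw [Matrix.mul_zero ((frame x)ᵀ * V * frame x), trace_zero, sub_zero]

theorem poissonBracket_eq_zero_of_sq_ne {φ ψ : BlockMatrix p q → ℂ} (hφ : Differentiable ℂ φ)
    (hφc : ∀ X Y, φ (X * Y) = φ (Y * X)) (hψ : Differentiable ℂ ψ)
    (hψc : ∀ X Y, ψ (X * Y) = ψ (Y * X)) (A F : Matrix (Fin p) (Fin q) ℝ) {c lam mu : ℂ}
    (hlam : IsRegular F c lam) (hmu : IsRegular F c mu) (hne : lam ^ 2 ≠ mu ^ 2)
    (x : PhaseSpace p q) :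
    poissonBracket (fun x => φ (deformedLax A F c lam x)) (fun x => ψ (deformedLax A F c mu x)) x
      = 0 := by
  obtain ⟨V, O, hVJ, hVt, hOJ, he, ho, hgrad⟩ := exists_gradient hφ hφc A F hlam x
  obtain ⟨V', O', hVJ', hVt', -, he', ho', hgrad'⟩ := exists_gradient hψ hψc A F hmu x
  obtain ⟨h1, h2, h3, h4⟩ := dEll_eq_trace hφ A F c lam x hgrad
  obtain ⟨h1', h2', h3', h4'⟩ := dEll_eq_trace hψ A F c mu x hgrad'
  rw [poissonBracket_eq_trace hVJ hVt hVJ' hVt' h1 h2 h3 h4 h1' h2' h3' h4']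
  have key := trace_involution_identity (laxS_anticomm F) (laxY_eq F c) hOJ he ho he' ho'
    hlam.1 hmu.1 hne
  rw [mul_eq_zero]
  right
  rw [← key]
  -- The identity is stated with `l'` and the bracket with `l`; the terms `½(ya + ay)` and `½(Vy +
  -- yV)` together account for the terms `tr(aVyV')` and `tr(aV'yV)`.
  simp only [configGradient, laxL']
  simp only [Matrix.mul_add, Matrix.add_mul, Matrix.mul_sub, Matrix.sub_mul, trace_add,
    trace_sub, trace_smul, smul_mul_assoc, mul_smul_comm, Matrix.mul_assoc, smul_eq_mul]
  simp only [trace_cycle₃ V, trace_cycle₃ V', trace_cycle₃ O, trace_cycle₃ O', Matrix.mul_assoc,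
    trace_cycle₄ (laxY F c)]
  ring

end Involution

/-! ### Smoothness, and extension to all spectral parameters by continuity. -/

section Spectral

open Matrix
open scoped Matrix.Norms.Operator

variable {p q : ℕ}

theorem contDiff_eval_entries (P : MvPolynomial ((Fin p ⊕ Fin q) × (Fin p ⊕ Fin q)) ℂ) :
    ContDiff ℂ (⊤ : ℕ∞) fun X : BlockMatrix p q => MvPolynomial.eval (fun ij => X ij.1 ij.2) P := by
  induction P using MvPolynomial.induction_on with
  | C a => simpa using contDiff_const
  | add P Q hP hQ => simpa using hP.add hQ
  | mul_X P ij hP =>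
    simp only [map_mul, MvPolynomial.eval_X]
    exact hP.mul (entryLinearMap ℂ ℂ ij.1 ij.2).toContinuousLinearMap.contDiff

theorem contDiff_charpoly_coeff (n : ℕ) :
    ContDiff ℂ (⊤ : ℕ∞) fun X : BlockMatrix p q => X.charpoly.coeff n := by
  -- The universal characteristic polynomial exhibits the coefficient as a polynomial in the
  -- entries.
  have e : (fun X : BlockMatrix p q => X.charpoly.coeff n) = fun X => MvPolynomial.eval
      (fun ij => X ij.1 ij.2) ((charpoly.univ ℂ (Fin p ⊕ Fin q)).coeff n) :=
    funext fun X => (charpoly.univ_coeff_eval₂Hom (Fin p ⊕ Fin q) (RingHom.id ℂ)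
      (fun ij => X ij.1 ij.2) n).symm
  rw [e]
  exact contDiff_eval_entries _

theorem contDiff_trace_pow (n : ℕ) :
    ContDiff ℂ (⊤ : ℕ∞) fun X : BlockMatrix p q => trace (X ^ n) :=
  (traceLinearMap (Fin p ⊕ Fin q) ℂ ℂ).toContinuousLinearMap.contDiff.comp (contDiff_id.pow n)

theorem trace_pow_mul_comm (n : ℕ) (X Y : BlockMatrix p q) :
    trace ((X * Y) ^ n) = trace ((Y * X) ^ n) := by
  cases n with
  | zero => simp
  | succ n =>
    rw [pow_succ', Matrix.mul_assoc, trace_mul_comm, Matrix.mul_assoc, mul_pow_mul,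
      ← Matrix.mul_assoc, ← pow_succ']

/-- On the phase space `k⁻¹ = kᵀ` and `r⁻¹ = rᵀ`, so the Lax matrix is given by a formula polynomial
in the entries of `k`, `ℓ`, `r`, `m` that makes sense for arbitrary matrices. -/
theorem isSmooth_comp_deformedLax {φ : BlockMatrix p q → ℂ} (hφ : ContDiff ℂ (⊤ : ℕ∞) φ)
    (A F : Matrix (Fin p) (Fin q) ℝ) (c lam : ℂ) :
    IsSmooth fun x => φ (deformedLax A F c lam x) := by
  let jl : (Fin p → Fin p → ℝ) →L[ℝ] BlockMatrix p q :=
    (blockLeft p q ∘ₗ (ofLinearEquiv ℝ).toLinearMap).toContinuousLinearMap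
  let jr : (Fin q → Fin q → ℝ) →L[ℝ] BlockMatrix p q :=
    (blockRight p q ∘ₗ (ofLinearEquiv ℝ).toLinearMap).toContinuousLinearMap
  let tr : BlockMatrix p q →L[ℝ] BlockMatrix p q :=
    (transposeLinearEquiv (Fin p ⊕ Fin q) (Fin p ⊕ Fin q) ℝ ℂ).toLinearMap.toContinuousLinearMap
  let K : (Fin p → Fin p → ℝ) × (Fin p → Fin p → ℝ) × (Fin q → Fin q → ℝ) × (Fin q → Fin q → ℝ) →
      BlockMatrix p q := fun z => jl z.1 + jr z.2.2.1
  let N : (Fin p → Fin p → ℝ) × (Fin p → Fin p → ℝ) × (Fin q → Fin q → ℝ) × (Fin q → Fin q → ℝ) →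
      BlockMatrix p q := fun z => jl z.2.1 + jr z.2.2.2
  have hK : ContDiff ℝ (⊤ : ℕ∞) K := by fun_prop
  have hN : ContDiff ℝ (⊤ : ℕ∞) N := by fun_prop
  have ht : ContDiff ℝ (⊤ : ℕ∞) fun z => tr (K z) := tr.contDiff.comp hK
  have ha : ContDiff ℝ (⊤ : ℕ∞) fun z => K z * laxS A * tr (K z) := (hK.mul contDiff_const).mul ht
  have hl : ContDiff ℝ (⊤ : ℕ∞) fun z => -(K z * N z * tr (K z)) := ((hK.mul hN).mul ht).neg
  have hL : ContDiff ℝ (⊤ : ℕ∞) fun z => (1 - lam⁻¹ • laxY F c)⁻¹ *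
      (lam • (K z * laxS A * tr (K z)) + (-(K z * N z * tr (K z)) - (1 / 2 : ℂ) •
        (laxY F c * (K z * laxS A * tr (K z)) + (K z * laxS A * tr (K z)) * laxY F c))
        + lam⁻¹ • laxS F) :=
    contDiff_const.mul (((ha.const_smul lam).add (hl.sub (((contDiff_const.mul ha).add
      (ha.mul contDiff_const)).const_smul (1 / 2 : ℂ)))).add contDiff_const)
  refine ⟨_, (hφ.restrict_scalars ℝ).comp hL, fun x => ?_⟩
  have eK : K (fun i j => x.k.1 i j, fun i j => x.l.1 i j, fun i j => x.r.1 i j,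
      fun i j => x.m.1 i j) = frame x := by
    change fromBlocks (complexify x.k.1) 0 0 0 + fromBlocks 0 0 0 (complexify x.r.1) = _
    simp [frame, fromBlocks_add]
  have eN : N (fun i j => x.k.1 i j, fun i j => x.l.1 i j, fun i j => x.r.1 i j,
      fun i j => x.m.1 i j) = momentum x := by
    change fromBlocks (complexify x.l.1) 0 0 0 + fromBlocks 0 0 0 (complexify x.m.1) = _
    simp [momentum, fromBlocks_add]
  simp only [Function.comp_apply, eK, eN]
  rw [deformedLax, laxL', laxA_eq, laxL_eq]
  rfl

theorem continuousAt_inv_one_sub {F : Matrix (Fin p) (Fin q) ℝ} {c mu : ℂ}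
    (h : IsRegular F c mu) : ContinuousAt (fun mu : ℂ => (1 - mu⁻¹ • laxY F c)⁻¹) mu := by
  obtain ⟨u, hu⟩ := h.2
  have h1 : ContinuousAt (fun mu : ℂ => 1 - mu⁻¹ • laxY F c) mu :=
    continuousAt_const.sub ((continuousAt_inv₀ h.1).smul continuousAt_const)
  have : CompleteSpace (BlockMatrix p q) := FiniteDimensional.complete ℂ _
  have h2 : ContinuousAt Ring.inverse (1 - mu⁻¹ • laxY F c) := by
    rw [← hu]; exact NormedRing.inverse_continuousAt u
  simp only [nonsing_inv_eq_ringInverse]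
  exact ContinuousAt.comp' h2 h1

theorem eventually_isRegular {F : Matrix (Fin p) (Fin q) ℝ} {c mu : ℂ}
    (h : IsRegular F c mu) : ∀ᶠ nu in nhds mu, IsRegular F c nu := by
  have h1 : ContinuousAt (fun mu : ℂ => (1 - mu⁻¹ • laxY F c).det) mu :=
    Continuous.matrix_det continuous_id |>.continuousAt.comp'
      (continuousAt_const.sub ((continuousAt_inv₀ h.1).smul continuousAt_const))
  have h2 := ((isUnit_iff_isUnit_det _).1 h.2).ne_zero
  filter_upwards [h1.eventually_ne h2, continuousAt_id.eventually_ne h.1] with nu h3 h4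
  exact ⟨h4, (isUnit_iff_isUnit_det _).2 (isUnit_iff_ne_zero.2 h3)⟩

/-- The chain rule makes the derivative explicit in `μ`; continuity then rests on that of `fderiv ℂ
ψ` and of matrix inversion at invertible matrices. -/
theorem continuousAt_deriv_comp_deformedLax {ψ : BlockMatrix p q → ℂ}
    (hψ : ContDiff ℂ (⊤ : ℕ∞) ψ) (A F : Matrix (Fin p) (Fin q) ℝ) {c mu : ℂ}
    (hmu : IsRegular F c mu) {γ : ℝ → PhaseSpace p q}
    {x : PhaseSpace p q} (hx : γ 0 = x) {Z N : BlockMatrix p q} (hZ : Zᵀ = -Z)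
    (hf : HasDerivAt (fun t => frame (γ t)) (frame x * Z) 0)
    (hm : HasDerivAt (fun t => momentum (γ t)) N 0) :
    ContinuousAt (fun mu => deriv (fun t => ψ (deformedLax A F c mu (γ t))) 0) mu := by
  simp only [deriv_comp_deformedLax (hψ.differentiable (by simp)) A F c _ hx hZ hf hm rfl]
  have hP := continuousAt_inv_one_sub hmu
  have hL : ContinuousAt (fun mu => deformedLax A F c mu x) mu :=
    hP.mul (((continuousAt_id.smul continuousAt_const).add continuousAt_const).add
      ((continuousAt_inv₀ hmu.1).smul continuousAt_const))
  have hD : ContinuousAt (fun mu => fderiv ℂ ψ (deformedLax A F c mu x)) mu :=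
    (hψ.continuous_fderiv (by simp)).continuousAt.comp' hL
  exact hD.clm_apply (hP.mul (continuousAt_const.add (continuousAt_id.smul continuousAt_const)))

theorem continuousAt_poissonBracket {ψ : BlockMatrix p q → ℂ}
    (hψ : ContDiff ℂ (⊤ : ℕ∞) ψ) (A F : Matrix (Fin p) (Fin q) ℝ) {c mu : ℂ}
    (hmu : IsRegular F c mu) (f : PhaseSpace p q → ℂ) (x : PhaseSpace p q) :
    ContinuousAt (fun mu => poissonBracket f (fun x => ψ (deformedLax A F c mu x)) x) mu := by
  have h1 : ∀ i j, ContinuousAt (fun mu => dEll (fun x => ψ (deformedLax A F c mu x)) x i j) mu :=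
    fun i j => continuousAt_deriv_comp_deformedLax hψ A F hmu
      (γ := fun t : ℝ => { x with l := x.l + t • gen i j }) (update_l_zero x (gen i j)) (Z := 0)
      (by simp) (hasDerivAt_frame_const x) (hasDerivAt_momentum_l x (gen i j))
  have h2 : ∀ i j, ContinuousAt (fun mu => dEm (fun x => ψ (deformedLax A F c mu x)) x i j) mu :=
    fun i j => continuousAt_deriv_comp_deformedLax hψ A F hmu
      (γ := fun t : ℝ => { x with m := x.m + t • gen i j }) (update_m_zero x (gen i j)) (Z := 0)
      (by simp) (hasDerivAt_frame_const x) (hasDerivAt_momentum_m x (gen i j))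
  have h3 : ∀ i j, ContinuousAt (fun mu => dK (fun x => ψ (deformedLax A F c mu x)) x i j) mu :=
    fun i j => continuousAt_deriv_comp_deformedLax hψ A F hmu
      (γ := fun t : ℝ => { x with k := x.k * expSO (t • gen i j) }) (update_k_zero x (gen i j))
      (transpose_blockLeft (gen i j)) (hasDerivAt_frame_k x (gen i j))
      (hasDerivAt_const (0 : ℝ) (momentum x))
  have h4 : ∀ i j, ContinuousAt (fun mu => dR (fun x => ψ (deformedLax A F c mu x)) x i j) mu :=
    fun i j => continuousAt_deriv_comp_deformedLax hψ A F hmu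
      (γ := fun t : ℝ => { x with r := x.r * expSO (t • gen i j) }) (update_r_zero x (gen i j))
      (transpose_blockRight (gen i j)) (hasDerivAt_frame_r x (gen i j))
      (hasDerivAt_const (0 : ℝ) (momentum x))
  unfold poissonBracket
  fun_prop

theorem poissonBracket_spectral_eq_zero {φ ψ : BlockMatrix p q → ℂ}
    (hφ : ContDiff ℂ (⊤ : ℕ∞) φ) (hφc : ∀ X Y, φ (X * Y) = φ (Y * X))
    (hψ : ContDiff ℂ (⊤ : ℕ∞) ψ) (hψc : ∀ X Y, ψ (X * Y) = ψ (Y * X))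
    (A F : Matrix (Fin p) (Fin q) ℝ) {c lam mu : ℂ}
    (hlam : IsRegular F c lam) (hmu : IsRegular F c mu) (x : PhaseSpace p q) :
    poissonBracket (fun x => φ (deformedLax A F c lam x)) (fun x => ψ (deformedLax A F c mu x)) x
      = 0 := by
  have hc := continuousAt_poissonBracket hψ A F hmu (fun x => φ (deformedLax A F c lam x)) x
  -- The neighbourhood is punctured because `μ` itself may equal `±λ`.
  have hroots : ∀ᶠ nu in nhdsWithin mu {mu}ᶜ, lam ^ 2 ≠ nu ^ 2 := by
    have hfin : ({lam, -lam} : Set ℂ).Finite := Set.toFinite _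
    have h1 : ∀ᶠ nu in nhdsWithin mu {mu}ᶜ, nu ∉ ({lam, -lam} : Set ℂ) := by
      have := (hfin.subset (Set.sdiff_subset (t := {mu}))).isClosed.isOpen_compl.mem_nhds
        (x := mu) (by simp)
      filter_upwards [mem_nhdsWithin_of_mem_nhds this, self_mem_nhdsWithin] with nu h2 h3 h4
      exact h2 ⟨h4, h3⟩
    filter_upwards [h1] with nu h2 h3
    rcases sq_eq_sq_iff_eq_or_eq_neg.1 h3.symm with h | h <;> exact h2 (by simp [h])
  have hev : ∀ᶠ nu in nhdsWithin mu {mu}ᶜ, poissonBracket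
      (fun x => φ (deformedLax A F c lam x)) (fun x => ψ (deformedLax A F c nu x)) x = 0 := by
    filter_upwards [hroots, (eventually_isRegular hmu).filter_mono nhdsWithin_le_nhds] with nu h1 h2
    exact poissonBracket_eq_zero_of_sq_ne (hφ.differentiable (by simp)) hφc
      (hψ.differentiable (by simp)) hψc A F hlam h2 h1 x
  -- The bracket vanishes on a punctured neighbourhood of `μ`, hence by continuity at `μ`.
  exact tendsto_nhds_unique (hc.tendsto.mono_left nhdsWithin_le_nhds)
    (tendsto_const_nhds.congr' (hev.mono fun _ h => h.symm))

theorem exists_of_mem_spectralInvariants {A F : Matrix (Fin p) (Fin q) ℝ} {c : ℂ}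
    {f : PhaseSpace p q → ℂ} (hf : f ∈ spectralInvariants A F c) :
    ∃ lam, IsRegular F c lam ∧ ∃ φ : BlockMatrix p q → ℂ, ContDiff ℂ (⊤ : ℕ∞) φ ∧
      (∀ X Y, φ (X * Y) = φ (Y * X)) ∧ f = fun x => φ (deformedLax A F c lam x) := by
  obtain ⟨lam, hlam, n, rfl | rfl⟩ := hf
  · exact ⟨lam, hlam, _, contDiff_trace_pow n, trace_pow_mul_comm n, rfl⟩
  · exact ⟨lam, hlam, _, contDiff_charpoly_coeff n,
      fun X Y => by rw [charpoly_mul_comm], rfl⟩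

end Spectral

end SpinTop

end

theorem mainTheorem1 (p q : ℕ) (A F : Matrix (Fin p) (Fin q) ℝ) (c : ℂ) :
    (∀ f ∈ SpinTop.spectralInvariants A F c, SpinTop.IsSmooth f) ∧
    (∀ f ∈ SpinTop.spectralInvariants A F c, ∀ g ∈ SpinTop.spectralInvariants A F c,
      ∀ x : SpinTop.PhaseSpace p q, SpinTop.poissonBracket f g x = 0) := by
  refine ⟨fun f hf => ?_, fun f hf g hg x => ?_⟩
  · obtain ⟨lam, -, φ, hφ, -, rfl⟩ := SpinTop.exists_of_mem_spectralInvariants hf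
    exact SpinTop.isSmooth_comp_deformedLax hφ A F c lam
  · obtain ⟨lam, hlam, φ, hφ, hφc, rfl⟩ := SpinTop.exists_of_mem_spectralInvariants hf
    obtain ⟨mu, hmu, ψ, hψ, hψc, rfl⟩ := SpinTop.exists_of_mem_spectralInvariants hg
    exact SpinTop.poissonBracket_spectral_eq_zero hφ hφc hψ hψc A F hlam hmu x
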